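/- For $\alpha\in\mathbb C\setminus(-\infty,0)$, with principal square roots and $x\coth x:=1$ at $x=0$, let $$S(\alpha)=-\frac1{8\pi^2}\int_0^\infty\frac{e^{-is}}{s^3}\Big\{2\sqrt{\pi\alpha}\,s\,\coth(2\sqrt{\pi\alpha}\,s)-1-\frac{4\pi\alpha s^2}{3}\Big\}\,ds$$ (an improper integral $\lim_{T\to\infty}\int_0^T$) be the Schwinger effective action for a constant external electric field. Let $$a_n=-\frac{(-1)^n}{8\pi^2}(16\pi)^nB_{2n}\frac{(2n-3)!}{(2n)!}\quad(n\ge2),$$ where $B_{2n}$ are the Bernoulli numbers, and $a_0=a_1=0$. Definitions. For a formal power series $\sum b_nz^n$ assume that its Borel transform $B(t)=\sum b_nt^n/n!$ converges for $|t|<C$ for some $C>0$ and continues analytically to the intersection of the upper half-plane with a neighbourhood of $[0,\infty)$, and that the limit $B(t+i0)=\lim_{\varepsilon\to0+}B(t+i\varepsilon)$ exists on $[0,\infty)$ in the sense of distributions. For $R>0$ let $C_R=\{z:\mathrm{Re}\,z^{-1}>R^{-1}\}$. If, for all $z\in C_R$, the integral $\frac1z\int_0^\infty D(t)e^{-t/z}\,dt$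 converges (as the limit over dilated smooth compactly supported cutoffs, equal to $1$ near $0$, independently of the cutoff), its value is called the upper sum, the lower sum, or the distributional Borel sum of the series on $C_R$ according as $D=B(t+i0)$, $D=\overline{B(t+i0)}$, or $D=\frac12\{B(t+i0)+\overline{B(t+i0)}\}$. Theorem. The integral defining $S(\alpha)$ converges for $|\arg\alpha|<\pi$, and $S$ is analytic there. One has $a_n>0$ for $n\ge2$ and $a_n$ grows like $(2n)!$ up to a geometric and a power factor, namely $a_n\sim\frac{(4/\pi)^n(2n)!}{32\pi^2n^3}$ as $n\to\infty$. The perturbation expansion of $S$ is $-\sum_{n\ge2}a_n\alpha^n$: for every $N\ge0$, $S(\alpha)+\sum_{n<N}a_n\alpha^n=O(\alpha^N)$ as $\alpha\to0$ with $\mathrm{Re}\,\alpha>0$. This expansion is Borel summable in the distributional sense in the variable $\beta=\sqrt\alpha$: for every $R>0$, the power series $-\sum_{n\ge2}a_n\beta^{2n}$ has on $C_R$ the upper sum $S(\beta^2)$, the lower sum $\overline{S(\overline{\beta^2})}$ and the distributional Borel sum $\frac12\{S(\beta^2)+\overline{S(\overline{\beta^2})}\}$. Since every $\beta$ with $\mathrm{Re}\,\beta>0$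 lies in some $C_R$, this covers all $\alpha=\beta^2$ with $|\arg\alpha|<\pi$, in particular $\mathrm{Re}\,\alpha>0$. For real $\alpha\ge0$ the function $\frac12\{S(\alpha)+\overline{S(\overline\alpha)}\}$ equals $\mathrm{Re}\,S(\alpha)$, and $S(0)=0$. -/

import Mathlib

open Complex Filter Topology MeasureTheory Asymptotics
open scoped Distributions ContDiff ComplexConjugate

namespace Schwinger

noncomputable section

/-! ### Distributional Borel summability -/

/-- The disk `C_R`, tangent to the imaginary axis at the origin. -/
def disk (R : ℝ) : Set ℂ := {z | R⁻¹ < (z⁻¹).re}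

/-- Value of a complex distribution on `ℝ` at a complex test function
(a Mathlib distribution acts on real test functions; this is its `ℂ`-linear extension). -/
def pair (T : 𝓓'((⊤ : TopologicalSpace.Opens ℝ), ℂ))
    (φ : 𝓓((⊤ : TopologicalSpace.Opens ℝ), ℂ)) : ℂ :=
  T (TestFunction.postcompCLM reCLM φ) + I * T (TestFunction.postcompCLM imCLM φ)

/-- The complex conjugate distribution. -/
def conjDist (T : 𝓓'((⊤ : TopologicalSpace.Opens ℝ), ℂ)) :
    𝓓'((⊤ : TopologicalSpace.Opens ℝ), ℂ) :=
  Distribution.mapCLM (conjCLE : ℂ →L[ℝ] ℂ) T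

/-- `PP(T) = (T + conj T) / 2`. -/
def PP (T : 𝓓'((⊤ : TopologicalSpace.Opens ℝ), ℂ)) :
    𝓓'((⊤ : TopologicalSpace.Opens ℝ), ℂ) :=
  (1 / 2 : ℝ) • (T + conjDist T)

/-- `T` is the boundary value `B(t + i0)`, `t ≥ 0`, of the Borel transform
`B(t) = ∑ bₙ tⁿ / n!` of the formal power series `∑ bₙ zⁿ`: the Borel transform converges in a
disk `|t| < C`, continues analytically to the intersection of the upper half-plane with a
neighbourhood `U` of `[0, ∞)`, and `T` is the distribution on `ℝ`, carried by `[0, ∞)`, which is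
the limit of `B(t + iε)` on `[0, ∞)` as `ε → 0+`. (Since `B` is analytic at `0`, the sharp cut
at `t = 0` is harmless.) -/
def IsBoundaryBorelTransform (b : ℕ → ℂ) (T : 𝓓'((⊤ : TopologicalSpace.Opens ℝ), ℂ)) : Prop :=
  ∃ (C : ℝ) (U : Set ℂ) (B : ℂ → ℂ), 0 < C ∧ IsOpen U ∧ (∀ t : ℝ, 0 ≤ t → (t : ℂ) ∈ U) ∧
    (∀ t ∈ Metric.ball (0 : ℂ) C, HasSum (fun n : ℕ => b n / (n.factorial : ℂ) * t ^ n) (B t)) ∧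
    DifferentiableOn ℂ B (Metric.ball 0 C ∪ (U ∩ {t | 0 < t.im})) ∧
    ∀ φ : 𝓓((⊤ : TopologicalSpace.Opens ℝ), ℝ),
      Tendsto (fun ε : ℝ => ∫ t in Set.Ioi (0 : ℝ), B (t + ε * I) * (φ t : ℂ))
        (𝓝[>] 0) (𝓝 (T φ))

/-- The test function `t ↦ χ(t / (m + 1)) exp(-t / z)`. -/
def laplaceTest (χ : 𝓓((⊤ : TopologicalSpace.Opens ℝ), ℝ)) (z : ℂ) (m : ℕ) :
    𝓓((⊤ : TopologicalSpace.Opens ℝ), ℂ) where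
  toFun t := (χ (t / ((m : ℝ) + 1)) : ℂ) * cexp (-(t : ℂ) / z)
  contDiff' := by
    have h1 : ContDiff ℝ ∞ (fun t : ℝ => χ (t / ((m : ℝ) + 1))) :=
      χ.contDiff.comp (contDiff_id.div_const _)
    have h2 : ContDiff ℝ ∞ (fun t : ℝ => (χ (t / ((m : ℝ) + 1)) : ℂ)) :=
      ofRealCLM.contDiff.comp h1
    have h3 : ContDiff ℝ ∞ (fun t : ℝ => (t : ℂ)) := ofRealCLM.contDiff
    exact h2.mul (h3.neg.div_const z).cexp
  hasCompactSupport' := by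
    have hm : ((m : ℝ) + 1)⁻¹ ≠ 0 := by positivity
    have h1 : HasCompactSupport (fun t : ℝ => χ (t / ((m : ℝ) + 1))) := by
      simp only [div_eq_mul_inv]
      exact χ.hasCompactSupport.comp_homeomorph (Homeomorph.mulRight₀ _ hm)
    have h2 : HasCompactSupport (fun t : ℝ => (χ (t / ((m : ℝ) + 1)) : ℂ)) :=
      h1.comp_left (g := fun x : ℝ => (x : ℂ)) ofReal_zero
    exact h2.mul_right
  tsupport_subset' := by simp

/-- The Laplace-Borel integral `z⁻¹ ∫₀^∞ T(t) exp(-t / z) dt` of a distribution `T` carried by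
`[0, ∞)` converges to `L`: for every smooth cutoff `χ` with compact support that equals `1` near
`0`, the values `z⁻¹ ⟨T, χ(t / m) exp(-t / z)⟩` tend to `L` as `m → ∞`. -/
def HasLaplaceBorelIntegral (T : 𝓓'((⊤ : TopologicalSpace.Opens ℝ), ℂ)) (z L : ℂ) : Prop :=
  ∀ χ : 𝓓((⊤ : TopologicalSpace.Opens ℝ), ℝ), (∀ᶠ t in 𝓝 (0 : ℝ), χ t = 1) →
    Tendsto (fun m : ℕ => z⁻¹ * pair T (laplaceTest χ z m)) atTop (𝓝 L)

/-- `∑ bₙ zⁿ` is Borel summable in the distributional sense to `f` on `C_R`. -/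
def IsDistBorelSum (b : ℕ → ℂ) (R : ℝ) (f : ℂ → ℂ) : Prop :=
  ∃ T, IsBoundaryBorelTransform b T ∧ ∀ z ∈ disk R, HasLaplaceBorelIntegral (PP T) z (f z)

/-- `Φ` is the upper sum of `∑ bₙ zⁿ` on `C_R`. -/
def IsUpperSum (b : ℕ → ℂ) (R : ℝ) (Φ : ℂ → ℂ) : Prop :=
  ∃ T, IsBoundaryBorelTransform b T ∧ ∀ z ∈ disk R, HasLaplaceBorelIntegral T z (Φ z)

/-- `Ψ` is the lower sum of `∑ bₙ zⁿ` on `C_R`. -/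
def IsLowerSum (b : ℕ → ℂ) (R : ℝ) (Ψ : ℂ → ℂ) : Prop :=
  ∃ T, IsBoundaryBorelTransform b T ∧ ∀ z ∈ disk R, HasLaplaceBorelIntegral (conjDist T) z (Ψ z)

/-- The coefficients of `∑ aₙ αⁿ` as a power series `∑ aₙ β²ⁿ` in `β = √α`. -/
def sqrtSeries (a : ℕ → ℂ) (k : ℕ) : ℂ := if Even k then a (k / 2) else 0

/-! ### The effective action -/

/-- The function `x coth x`, with value `1` at `0`. -/
def xcoth (x : ℂ) : ℂ := if x = 0 then 1 else x * (cosh x / sinh x)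

/-- The integrand of the effective action. -/
def integrand (α : ℂ) (s : ℝ) : ℂ :=
  cexp (-I * s) / (s : ℂ) ^ 3 *
    (xcoth (2 * ((Real.pi : ℂ) * α) ^ (1 / 2 : ℂ) * s) - 1 - 4 * Real.pi * α * (s : ℂ) ^ 2 / 3)

/-- The effective action integrated up to `T`. -/
def actionUpTo (α : ℂ) (T : ℝ) : ℂ :=
  -(1 / (8 * (Real.pi : ℂ) ^ 2)) * ∫ s in (0 : ℝ)..T, integrand α s

/-- The effective action `S(α)`, a conditionally convergent improper integral. -/
def S (α : ℂ) : ℂ := limUnder atTop (actionUpTo α)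

/-- The numbers `aₙ`, with `aₙ = 0` for `n < 2`. -/
def a (n : ℕ) : ℝ :=
  if n < 2 then 0 else
    -((-1) ^ n / (8 * Real.pi ^ 2)) * (16 * Real.pi) ^ n * (bernoulli (2 * n) : ℝ) *
      ((2 * n - 3).factorial / (2 * n).factorial)

/-- The coefficients `-aₙ` of the perturbation expansion of `S(α)`. -/
def coeff (n : ℕ) : ℂ := -(a n : ℂ)

end

end Schwinger

/-!
The Mittag-Leffler expansion of `coth` turns `S(β²)` into a sum over `k` of the oscillating
integrals `∫ e^{-is} s / (1 + w² s²) ds` with `w = β / r_k`. Rotating the ray of integration and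
integrating by parts, each of them becomes the Laplace integral of a kernel whose third derivative
is `u / (1 - u²)`, evaluated at `u = t / r_k`. Summing over `k`,
`S(β²) = β⁻¹ ∫₀^∞ B(t + i0) e^{-t/β} dt`, where `B(t)` is `-1 / (4π²)` times the sum of the kernel
over these arguments. `B` is holomorphic in the upper half-plane and near `0`, and it grows at most
like `|t|⁴`. Its Taylor coefficients at `0` are values of the zeta function at even integers, that
is, Bernoulli numbers, and Watson's lemma gives the expansion of `S`.
-/

namespace Schwinger

noncomputable section

theorem hasFPowerSeriesOnBall_ofScalars_of_hasSum {c : ℕ → ℂ} {f : ℂ → ℂ} {r : ℝ} (hr : 0 < r)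
    (h : ∀ z : ℂ, ‖z‖ < r → HasSum (fun n => c n * z ^ n) (f z)) :
    HasFPowerSeriesOnBall f (.ofScalars ℂ c) 0 (.ofReal r) where
  r_pos := ENNReal.ofReal_pos.2 hr
  r_le := by
    refine ENNReal.le_of_forall_nnreal_lt fun q hq => ?_
    have hqr : ‖((q : ℝ) : ℂ)‖ < r := by
      simpa using (ENNReal.lt_ofReal_iff_toReal_lt ENNReal.coe_ne_top).1 hq
    refine FormalMultilinearSeries.le_radius_of_tendsto _ (l := 0) ?_
    simpa [FormalMultilinearSeries.ofScalars_norm] using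
      (h _ hqr).summable.tendsto_atTop_zero.norm
  hasSum {y} hy := by
    have hy' : ‖y‖ < r := by simpa [← ofReal_norm, ENNReal.ofReal_lt_ofReal_iff hr] using hy
    simpa [FormalMultilinearSeries.ofScalars_apply_eq, mul_comm] using h y hy'

theorem exists_norm_le_of_isBigO {f g : ℂ → ℂ} {s : Set ℂ} (hs : IsClosed s)
    (hf : ContinuousOn f s) (hg : ContinuousOn g s) (hg0 : ∀ u ∈ s, u ≠ 0 → g u ≠ 0)
    (hzero : f =O[𝓝 0] g) (hinfty : f =O[Bornology.cobounded ℂ] g) :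
    ∃ C : ℝ, ∀ u ∈ s, ‖f u‖ ≤ C * ‖g u‖ := by
  rw [← isBigO_principal]
  obtain ⟨c, hc⟩ := hzero.bound
  obtain ⟨r, hr, hball⟩ := Metric.mem_nhds_iff.1 hc
  obtain ⟨c', hc'⟩ := hinfty.bound
  obtain ⟨R, -, hball'⟩ := Metric.hasBasis_cobounded_compl_closedBall (0 : ℂ) |>.mem_iff.1 hc'
  have hK : IsCompact (s ∩ (Metric.closedBall 0 R \ Metric.ball 0 r)) :=
    ((isCompact_closedBall 0 R).diff Metric.isOpen_ball).inter_left hs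
  have hgK : ∀ u ∈ s ∩ (Metric.closedBall 0 R \ Metric.ball 0 r), g u ≠ 0 := fun u hu =>
    hg0 u hu.1 fun h => hu.2.2 (by simpa [h] using hr)
  obtain ⟨B, hB⟩ := hK.exists_bound_of_continuousOn
    ((hf.mono Set.inter_subset_left).div (hg.mono Set.inter_subset_left) hgK)
  have hmid : f =O[𝓟 (s ∩ (Metric.closedBall 0 R \ Metric.ball 0 r))] g :=
    isBigO_principal.2 ⟨B, fun u hu => by
      rw [← div_le_iff₀ (norm_pos_iff.2 (hgK u hu)), ← norm_div]
      exact hB u hu⟩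
  have h0 : f =O[𝓟 (Metric.ball 0 r)] g := isBigO_principal.2 ⟨c, fun u hu => hball hu⟩
  have h1 : f =O[𝓟 (Metric.closedBall 0 R)ᶜ] g := isBigO_principal.2 ⟨c', fun u hu => hball' hu⟩
  refine ((hmid.sup h0).sup h1).mono ?_
  simp only [sup_principal, principal_mono]
  intro u hu
  by_cases hur : u ∈ Metric.ball (0 : ℂ) r <;> by_cases huR : u ∈ Metric.closedBall (0 : ℂ) R <;>
    simp_all

/-! ### Laplace integrals -/

theorem norm_cexp_neg_mul (p : ℂ) (t : ℝ) : ‖cexp (-(p * t))‖ = Real.exp (-(p.re * t)) := by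
  simp [Complex.norm_exp]

theorem integrableOn_pow_mul_exp_neg_mul (n : ℕ) {c : ℝ} (hc : 0 < c) :
    IntegrableOn (fun t : ℝ => t ^ n * Real.exp (-(c * t))) (Set.Ioi 0) := by
  have h := integrableOn_rpow_mul_exp_neg_mul_rpow (p := 1) (s := n) (b := c)
    (neg_one_lt_zero.trans_le n.cast_nonneg) one_pos hc
  simpa [Real.rpow_natCast] using h

theorem integral_pow_mul_exp_neg_mul (n : ℕ) {c : ℝ} (hc : 0 < c) :
    ∫ t in Set.Ioi (0 : ℝ), t ^ n * Real.exp (-(c * t)) = n.factorial / c ^ (n + 1) := by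
  have h := Real.integral_rpow_mul_exp_neg_mul_Ioi (a := n + 1) (r := c) (by positivity) hc
  rw [Real.Gamma_nat_eq_factorial, ← Nat.cast_succ, Real.rpow_natCast] at h
  simpa [Real.rpow_natCast, div_eq_inv_mul] using h

theorem hasDerivAt_cexp_neg_mul (p : ℂ) (t : ℝ) :
    HasDerivAt (fun t : ℝ => cexp (-(p * t))) (cexp (-(p * t)) * -p) t := by
  simpa using ((hasDerivAt_id t).ofReal_comp.const_mul p).fun_neg.cexp

theorem isLittleO_mul_cexp_neg_mul {f : ℝ → ℂ} {m : ℕ} (hf : f =O[atTop] fun t : ℝ => t ^ m)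
    {p : ℂ} {c : ℝ} (hc : c < p.re) :
    (fun t : ℝ => f t * cexp (-(p * t))) =o[atTop] fun t => Real.exp (-c * t) := by
  have hexp : (fun t : ℝ => cexp (-(p * t))) =O[atTop] fun t => Real.exp (-(p.re * t)) :=
    .of_norm_left <| by simpa only [norm_cexp_neg_mul] using isBigO_refl _ _
  have hpow : (fun t : ℝ => t ^ m) =o[atTop] fun t => Real.exp ((p.re - c) * t) :=
    isLittleO_pow_exp_pos_mul_atTop m (sub_pos.2 hc)
  refine ((hf.trans_isLittleO hpow).mul_isBigO hexp).congr_right fun t => ?_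
  rw [← Real.exp_add]
  ring_nf

theorem integrableOn_mul_cexp_of_isBigO {f : ℝ → ℂ} {m : ℕ} (hf : ContinuousOn f (Set.Ici 0))
    (hfO : f =O[atTop] fun t : ℝ => t ^ m) {p : ℂ} (hp : 0 < p.re) :
    IntegrableOn (fun t : ℝ => f t * cexp (-(p * t))) (Set.Ioi 0) :=
  ((ContinuousOn.mul hf (by fun_prop)).locallyIntegrableOn measurableSet_Ici
    |>.integrableOn_of_isBigO_atTop (isLittleO_mul_cexp_neg_mul hfO (half_lt_self hp)).isBigO
      ⟨_, Ioi_mem_atTop 0, exp_neg_integrableOn_Ioi 0 (half_pos hp)⟩).mono_set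
        Set.Ioi_subset_Ici_self

theorem mul_integral_mul_cexp_eq {f f' : ℝ → ℂ} {m : ℕ} {p : ℂ} (hp : 0 < p.re)
    (hf : ContinuousOn f (Set.Ici 0)) (hff' : ∀ t : ℝ, 0 < t → HasDerivAt f (f' t) t)
    (hfO : f =O[atTop] fun t : ℝ => t ^ m)
    (hf' : IntegrableOn (fun t : ℝ => f' t * cexp (-(p * t))) (Set.Ioi 0)) :
    p * ∫ t in Set.Ioi (0 : ℝ), f t * cexp (-(p * t)) =
      f 0 + ∫ t in Set.Ioi (0 : ℝ), f' t * cexp (-(p * t)) := by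
  have hfp := (integrableOn_mul_cexp_of_isBigO hf hfO hp).const_mul p
  have hlim : Tendsto (fun t : ℝ => f t * cexp (-(p * t))) atTop (𝓝 0) := by
    simpa using isLittleO_mul_cexp_neg_mul hfO hp
  have h := integral_Ioi_of_hasDerivAt_of_tendsto
    ((hf.mul (by fun_prop)).continuousWithinAt Set.self_mem_Ici)
    (fun t ht => ((hff' t ht).fun_mul (hasDerivAt_cexp_neg_mul p t)).congr_deriv
      (by ring : _ = f' t * cexp (-(p * t)) - p * (f t * cexp (-(p * t)))))
    (hf'.sub hfp) hlim
  rw [integral_sub hf' hfp, integral_const_mul] at h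
  simp only [Pi.mul_apply, ofReal_zero, mul_zero, neg_zero, Complex.exp_zero, mul_one,
    zero_sub] at h
  linear_combination -h

theorem integrableOn_pow_mul_cexp (n : ℕ) {p : ℂ} (hp : 0 < p.re) :
    IntegrableOn (fun t : ℝ => (t : ℂ) ^ n * cexp (-(p * t))) (Set.Ioi 0) :=
  integrableOn_mul_cexp_of_isBigO (m := n) (by fun_prop)
    (.of_norm_left <| by simpa using (isBigO_refl (fun t : ℝ => t ^ n) atTop).norm_left) hp

theorem integral_pow_mul_cexp_neg_mul (n : ℕ) {p : ℂ} (hp : 0 < p.re) :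
    ∫ t in Set.Ioi (0 : ℝ), (t : ℂ) ^ n * cexp (-(p * t)) = n.factorial / p ^ (n + 1) := by
  have hp0 : p ≠ 0 := by rintro rfl; simp at hp
  induction n with
  | zero =>
    have h := integral_exp_mul_complex_Ioi (a := -p) (by simpa using hp) 0
    simpa using h
  | succ n ih =>
    have hderiv (t : ℝ) :
        HasDerivAt (fun t : ℝ => (t : ℂ) ^ (n + 1)) ((n + 1) * (t : ℂ) ^ n) t := by
      simpa using (hasDerivAt_id t).ofReal_comp.fun_pow (n + 1)
    have h := mul_integral_mul_cexp_eq (m := n + 1) hp (by fun_prop) (fun t _ => hderiv t)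
      (.of_norm_left <| by simpa using (isBigO_refl (fun t : ℝ => t ^ (n + 1)) atTop).norm_left)
      (by simpa only [mul_assoc, IntegrableOn] using
        (integrableOn_pow_mul_cexp n hp).const_mul (n + 1 : ℂ))
    simp only [mul_assoc, integral_const_mul, ih] at h
    rw [eq_div_iff (pow_ne_zero _ hp0), pow_succ', mul_left_comm, ← mul_assoc, h,
      Nat.factorial_succ]
    push_cast
    field_simp
    simp

theorem sum_div_factorial_mul_cexp (b : ℕ → ℂ) (n : ℕ) (p : ℂ) (t : ℝ) :
    (∑ j ∈ Finset.range n, b j / j.factorial * (t : ℂ) ^ j) * cexp (-(p * t)) =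
      ∑ j ∈ Finset.range n, b j / j.factorial * ((t : ℂ) ^ j * cexp (-(p * t))) := by
  simp only [Finset.sum_mul, mul_assoc]

theorem integrableOn_sum_mul_cexp (b : ℕ → ℂ) (n : ℕ) {p : ℂ} (hp : 0 < p.re) :
    IntegrableOn (fun t : ℝ =>
      (∑ j ∈ Finset.range n, b j / j.factorial * (t : ℂ) ^ j) * cexp (-(p * t))) (Set.Ioi 0) := by
  simpa only [sum_div_factorial_mul_cexp, IntegrableOn] using
    integrable_finsetSum _ fun j _ => (integrableOn_pow_mul_cexp j hp).const_mul _

theorem inv_mul_integral_sum_mul_cexp (b : ℕ → ℂ) (n : ℕ) {β : ℂ} (hβ : 0 < β⁻¹.re) :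
    β⁻¹ * (∫ t in Set.Ioi (0 : ℝ),
      (∑ j ∈ Finset.range n, b j / j.factorial * (t : ℂ) ^ j) * cexp (-(β⁻¹ * t))) =
        ∑ j ∈ Finset.range n, b j * β ^ j := by
  have hβ0 : β ≠ 0 := by rintro rfl; simp at hβ
  simp only [sum_div_factorial_mul_cexp]
  rw [integral_finsetSum _ fun j _ => (integrableOn_pow_mul_cexp j hβ).const_mul _, Finset.mul_sum]
  refine Finset.sum_congr rfl fun j _ => ?_
  have := Nat.cast_ne_zero (R := ℂ).2 j.factorial_ne_zero
  rw [integral_const_mul, integral_pow_mul_cexp_neg_mul j hβ, inv_pow, pow_succ]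
  field_simp

section PolynomiallyBounded

variable {f : ℝ → ℂ} {C : ℝ} {n : ℕ} {p : ℂ}

theorem norm_mul_cexp_le (hfC : ∀ t : ℝ, 0 < t → ‖f t‖ ≤ C * t ^ n) {c t : ℝ} (hc : c ≤ p.re)
    (ht : 0 < t) : ‖f t * cexp (-(p * t))‖ ≤ C * (t ^ n * Real.exp (-(c * t))) := by
  rw [norm_mul, norm_cexp_neg_mul, ← mul_assoc]
  gcongr
  exacts [(norm_nonneg _).trans (hfC t ht), hfC t ht]

theorem integrableOn_mul_cexp (hf : AEStronglyMeasurable f (volume.restrict (Set.Ioi 0)))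
    (hfC : ∀ t : ℝ, 0 < t → ‖f t‖ ≤ C * t ^ n) (hp : 0 < p.re) :
    IntegrableOn (fun t : ℝ => f t * cexp (-(p * t))) (Set.Ioi 0) := by
  refine ((integrableOn_pow_mul_exp_neg_mul n hp).const_mul C).mono'
    (hf.mul (by fun_prop : Continuous _).aestronglyMeasurable) ?_
  filter_upwards [ae_restrict_mem measurableSet_Ioi] with t ht
  exact norm_mul_cexp_le hfC le_rfl ht

theorem norm_integral_mul_cexp_le (hfC : ∀ t : ℝ, 0 < t → ‖f t‖ ≤ C * t ^ n) (hp : 0 < p.re) :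
    ‖∫ t in Set.Ioi (0 : ℝ), f t * cexp (-(p * t))‖ ≤ C * (n.factorial / p.re ^ (n + 1)) := by
  rw [← integral_pow_mul_exp_neg_mul n hp, ← integral_const_mul]
  refine norm_integral_le_of_norm_le ((integrableOn_pow_mul_exp_neg_mul n hp).const_mul C) ?_
  filter_upwards [ae_restrict_mem measurableSet_Ioi] with t ht
  exact norm_mul_cexp_le hfC le_rfl ht

/-- Watson's lemma. -/
theorem norm_inv_mul_integral_mul_cexp_sub_sum_le
    (hf : AEStronglyMeasurable f (volume.restrict (Set.Ioi 0))) {b : ℕ → ℂ}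
    (hfC : ∀ t : ℝ, 0 < t →
      ‖f t - ∑ j ∈ Finset.range n, b j / j.factorial * (t : ℂ) ^ j‖ ≤ C * t ^ n)
    {β : ℂ} (hβ : 0 < β⁻¹.re) :
    ‖β⁻¹ * (∫ t in Set.Ioi (0 : ℝ), f t * cexp (-(β⁻¹ * t)))
        - ∑ j ∈ Finset.range n, b j * β ^ j‖ ≤
      ‖β‖⁻¹ * (C * (n.factorial / β⁻¹.re ^ (n + 1))) := by
  set P : ℝ → ℂ := fun t => ∑ j ∈ Finset.range n, b j / j.factorial * (t : ℂ) ^ j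
  have hPm : AEStronglyMeasurable P (volume.restrict (Set.Ioi 0)) :=
    (by fun_prop : Continuous P).aestronglyMeasurable
  have hrem := integrableOn_mul_cexp (hf.sub hPm) hfC hβ
  have hsum : ∫ t in Set.Ioi (0 : ℝ), f t * cexp (-(β⁻¹ * t)) =
      (∫ t in Set.Ioi (0 : ℝ), (f t - P t) * cexp (-(β⁻¹ * t))) +
        ∫ t in Set.Ioi (0 : ℝ), P t * cexp (-(β⁻¹ * t)) := by
    refine Eq.trans ?_ (integral_add hrem (integrableOn_sum_mul_cexp b n hβ))
    simp only [sub_mul, sub_add_cancel, P]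
  rw [hsum, mul_add, inv_mul_integral_sum_mul_cexp b n hβ, add_sub_cancel_right, norm_mul, norm_inv]
  gcongr
  exact norm_integral_mul_cexp_le hfC hβ

end PolynomiallyBounded

/-! ### Holomorphic parameter integrals -/

section ParametricIntegral

variable {α : Type*} [MeasurableSpace α] {μ : Measure α}
  {E : Type*} [NormedAddCommGroup E] [NormedSpace ℂ E]

theorem aestronglyMeasurable_of_hasDerivAt {F : ℂ → α → E} {F' : α → E} {z₀ : ℂ}
    (hmeas : ∀ᶠ z in 𝓝 z₀, AEStronglyMeasurable (F z) μ)
    (hderiv : ∀ᵐ s ∂μ, HasDerivAt (fun z => F z s) (F' s) z₀) : AEStronglyMeasurable F' μ := by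
  obtain ⟨u, hu, hum⟩ := exists_seq_forall_of_frequently (hmeas.filter_mono
    (nhdsWithin_le_nhds (s := {z₀}ᶜ))).frequently
  refine aestronglyMeasurable_of_tendsto_ae atTop
    (fun n => ((hum n).sub hmeas.self_of_nhds).const_smul (u n - z₀)⁻¹) ?_
  filter_upwards [hderiv] with s hs
  exact (hasDerivAt_iff_tendsto_slope.1 hs).comp hu

theorem differentiableAt_integral_of_dominated {F : ℂ → α → E} {z₀ : ℂ} {U : Set ℂ}
    (hU : U ∈ 𝓝 z₀) {b : α → ℝ} (hb : Integrable b μ)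
    (hmeas : ∀ z ∈ U, AEStronglyMeasurable (F z) μ)
    (hdiff : ∀ᵐ s ∂μ, DifferentiableOn ℂ (fun z => F z s) U)
    (hbound : ∀ᵐ s ∂μ, ∀ z ∈ U, ‖F z s‖ ≤ b s) :
    DifferentiableAt ℂ (fun z => ∫ s, F z s ∂μ) z₀ := by
  obtain ⟨r, hr, hrU⟩ := Metric.nhds_basis_closedBall.mem_iff.1 hU
  have hsub {z y : ℂ} (hz : z ∈ Metric.ball z₀ (r / 2)) (hy : y ∈ Metric.closedBall z (r / 2)) :
      y ∈ U :=
    hrU <| Metric.closedBall_subset_closedBall' (by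
      linarith [Metric.mem_ball.1 hz]) hy
  have hderiv : ∀ᵐ s ∂μ, ∀ z ∈ Metric.ball z₀ (r / 2),
      HasDerivAt (fun z => F z s) (deriv (fun z => F z s) z) z := by
    filter_upwards [hdiff] with s hs z hz
    exact (hs.differentiableAt (mem_of_superset
      (Metric.closedBall_mem_nhds z (half_pos hr)) fun y => hsub hz)).hasDerivAt
  have hmeas' : ∀ᶠ z in 𝓝 z₀, AEStronglyMeasurable (F z) μ := mem_of_superset hU hmeas
  refine (hasDerivAt_integral_of_dominated_loc_of_deriv_le (F' := fun z s => deriv (F · s) z)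
    (Metric.ball_mem_nhds z₀ (half_pos hr)) hmeas'
    (hb.mono' hmeas'.self_of_nhds <| hbound.mono fun s hs => hs z₀ (mem_of_mem_nhds hU))
    (aestronglyMeasurable_of_hasDerivAt hmeas' <| hderiv.mono fun s hs =>
      hs z₀ (Metric.mem_ball_self (half_pos hr)))
    (bound := fun s => b s / (r / 2)) ?_ (hb.div_const _) hderiv).2.differentiableAt
  filter_upwards [hdiff, hbound] with s hs hbs z hz
  exact norm_deriv_le_of_forall_mem_sphere_norm_le (half_pos hr)
    ((hs.mono fun y => hsub hz).diffContOnCl_ball subset_rfl)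
    fun y hy => hbs y (hsub hz (Metric.sphere_subset_closedBall hy))

theorem differentiableOn_integral_mul_cexp {f : ℝ → ℂ} {C : ℝ} {n : ℕ}
    (hf : AEStronglyMeasurable f (volume.restrict (Set.Ioi 0)))
    (hfC : ∀ t : ℝ, 0 < t → ‖f t‖ ≤ C * t ^ n) :
    DifferentiableOn ℂ (fun p => ∫ t in Set.Ioi (0 : ℝ), f t * cexp (-(p * t)))
      {p | 0 < p.re} := by
  intro p hp
  have hU : {q : ℂ | p.re / 2 < q.re} ∈ 𝓝 p :=
    (isOpen_lt continuous_const continuous_re).mem_nhds (half_lt_self hp : p.re / 2 < p.re)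
  refine (differentiableAt_integral_of_dominated hU
    ((integrableOn_pow_mul_exp_neg_mul n (half_pos hp)).const_mul C)
    (fun q _ => hf.mul (by fun_prop : Continuous _).aestronglyMeasurable)
    (.of_forall fun t => (by fun_prop : Differentiable ℂ fun q : ℂ =>
      f t * cexp (-(q * t))).differentiableOn) ?_).differentiableWithinAt
  filter_upwards [ae_restrict_mem measurableSet_Ioi] with t ht q hq
  exact norm_mul_cexp_le hfC (le_of_lt hq) ht

end ParametricIntegral

/-! ### Functions regular up to the boundary of the upper half-plane -/

/-- `f` is holomorphic in the upper half-plane, extends continuously to the real axis (through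
its values there), and is bounded by a multiple of `‖u‖ ^ n`. The values `f t`, `t` real, are
thus the boundary values `f (t + i0)`. -/
structure IsUpperRegular (n : ℕ) (f : ℂ → ℂ) : Prop where
  differentiableOn : DifferentiableOn ℂ f {u | 0 < u.im}
  continuousOn : ContinuousOn f {u | 0 ≤ u.im}
  exists_norm_le : ∃ C : ℝ, ∀ u : ℂ, 0 ≤ u.im → ‖f u‖ ≤ C * ‖u‖ ^ n

namespace IsUpperRegular

variable {n : ℕ} {f : ℂ → ℂ}

theorem const_mul (hf : IsUpperRegular n f) (c : ℂ) : IsUpperRegular n fun u => c * f u where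
  differentiableOn := hf.differentiableOn.const_mul c
  continuousOn := hf.continuousOn.const_mul c
  exists_norm_le := by
    obtain ⟨C, hC⟩ := hf.exists_norm_le
    refine ⟨‖c‖ * C, fun u hu => ?_⟩
    rw [norm_mul, mul_assoc]
    gcongr
    exact hC u hu

theorem exists_nonneg_norm_le (hf : IsUpperRegular n f) :
    ∃ C : ℝ, 0 ≤ C ∧ ∀ u : ℂ, 0 ≤ u.im → ‖f u‖ ≤ C * ‖u‖ ^ n := by
  obtain ⟨C, hC⟩ := hf.exists_norm_le
  refine ⟨C, ?_, hC⟩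
  simpa using (norm_nonneg _).trans (hC 1 (by simp))

section Dilations

variable {r : ℕ → ℝ}

theorem exists_norm_comp_div_le (hf : IsUpperRegular n f) (hr : ∀ k, 0 < r k) :
    ∃ C : ℝ, 0 ≤ C ∧ ∀ (k : ℕ) (u : ℂ), 0 ≤ u.im → ‖f (u / r k)‖ ≤ C * ‖u‖ ^ n * (r k ^ n)⁻¹ := by
  obtain ⟨C, hC0, hC⟩ := hf.exists_nonneg_norm_le
  refine ⟨C, hC0, fun k u hu => ?_⟩
  have h := hC (u / r k) (by rw [div_ofReal_im]; exact div_nonneg hu (hr k).le)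
  rwa [norm_div, norm_real, Real.norm_of_nonneg (hr k).le, div_pow, ← mul_div_assoc,
    div_eq_mul_inv (_ * _)] at h

theorem summable_comp_div (hf : IsUpperRegular n f) (hr : ∀ k, 0 < r k)
    (hsum : Summable fun k => (r k ^ n)⁻¹) {u : ℂ} (hu : 0 ≤ u.im) :
    Summable fun k => f (u / r k) := by
  obtain ⟨C, -, hC⟩ := hf.exists_norm_comp_div_le hr
  exact .of_norm_bounded (hsum.mul_left _) fun k => hC k u hu

theorem tsum_comp_div (hf : IsUpperRegular n f) (hr : ∀ k, 0 < r k)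
    (hsum : Summable fun k => (r k ^ n)⁻¹) :
    IsUpperRegular n fun u => ∑' k, f (u / r k) := by
  obtain ⟨C, hC0, hC⟩ := hf.exists_norm_comp_div_le hr
  have hC' {B : ℝ} (k : ℕ) {u : ℂ} (hu : 0 ≤ u.im) (huB : ‖u‖ < B) :
      ‖f (u / r k)‖ ≤ C * B ^ n * (r k ^ n)⁻¹ := by
    have := inv_nonneg.2 (pow_nonneg (hr k).le n)
    exact (hC k u hu).trans (by gcongr)
  have hdiv (k : ℕ) : Continuous fun u : ℂ => u / r k := continuous_id.div_const _
  refine ⟨fun u hu => ?_, fun u hu => ?_, C * ∑' k, (r k ^ n)⁻¹, fun u hu => ?_⟩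
  · have hopen : IsOpen ({u : ℂ | 0 < u.im} ∩ {v | ‖v‖ < ‖u‖ + 1}) :=
      (isOpen_lt continuous_const continuous_im).inter (isOpen_lt continuous_norm continuous_const)
    have h := differentiableOn_tsum_of_summable_norm (F := fun k u => f (u / r k))
      (hsum.mul_left (C * (‖u‖ + 1) ^ n))
      (fun k => hf.differentiableOn.comp (by fun_prop) fun v hv => by
        simpa [div_ofReal_im] using div_pos hv.1 (hr k))
      hopen fun k v hv => hC' k (le_of_lt hv.1) hv.2
    exact (h.differentiableAt (hopen.mem_nhds ⟨hu, by simp⟩)).differentiableWithinAt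
  · have h := continuousOn_tsum (f := fun k u => f (u / r k))
      (s := {u : ℂ | 0 ≤ u.im} ∩ {v | ‖v‖ < ‖u‖ + 1})
      (fun k => hf.continuousOn.comp (hdiv k).continuousOn fun v hv => by
        simpa [div_ofReal_im] using div_nonneg hv.1 (hr k).le)
      (hsum.mul_left (C * (‖u‖ + 1) ^ n)) fun k v hv => hC' k hv.1 hv.2
    exact (h u ⟨hu, by simp⟩).mono_of_mem_nhdsWithin <| inter_mem_nhdsWithin _ <|
      (isOpen_lt continuous_norm continuous_const).mem_nhds (by simp)
  · refine (tsum_of_norm_bounded (hsum.mul_left (C * ‖u‖ ^ n)).hasSum fun k => hC k u hu).trans ?_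
    rw [tsum_mul_left]
    exact (mul_right_comm _ _ _).le

end Dilations

theorem continuous_ofReal (hf : IsUpperRegular n f) : Continuous fun t : ℝ => f t :=
  hf.continuousOn.comp_continuous Complex.continuous_ofReal fun _ => by simp

theorem exists_norm_ofReal_le (hf : IsUpperRegular n f) :
    ∃ C : ℝ, 0 ≤ C ∧ ∀ t : ℝ, 0 < t → ‖f t‖ ≤ C * t ^ n := by
  obtain ⟨C, hC0, hC⟩ := hf.exists_nonneg_norm_le
  exact ⟨C, hC0, fun t ht => by simpa [abs_of_pos ht] using hC t (by simp)⟩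

theorem differentiableOn_laplace (hf : IsUpperRegular n f) :
    DifferentiableOn ℂ (fun p => ∫ t in Set.Ioi (0 : ℝ), f t * cexp (-(p * t)))
      {p | 0 < p.re} := by
  obtain ⟨C, -, hC⟩ := hf.exists_norm_ofReal_le
  exact differentiableOn_integral_mul_cexp hf.continuous_ofReal.aestronglyMeasurable hC

theorem hasSum_laplace_comp_div (hf : IsUpperRegular n f) {r : ℕ → ℝ} (hr : ∀ k, 0 < r k)
    (hsum : Summable fun k => (r k ^ n)⁻¹) {p : ℂ} (hp : 0 < p.re) :
    HasSum (fun k => ∫ t in Set.Ioi (0 : ℝ), f (t / r k) * cexp (-(p * t)))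
      (∫ t in Set.Ioi (0 : ℝ), (∑' k, f (t / r k)) * cexp (-(p * t))) := by
  obtain ⟨C, -, hC⟩ := hf.exists_norm_comp_div_le hr
  refine hasSum_integral_of_dominated_convergence
    (fun k t => (r k ^ n)⁻¹ * (C * (t ^ n * Real.exp (-(p.re * t))))) (fun k => ?_) (fun k => ?_)
    (.of_forall fun t => hsum.mul_right _) ?_ (.of_forall fun t =>
      (hf.summable_comp_div hr hsum (by simp)).hasSum.mul_right _)
  · have hcont : Continuous fun t : ℝ => f (t / r k) := by
      simpa [Function.comp_def] using hf.continuous_ofReal.comp (continuous_id.div_const (r k))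
    exact (hcont.mul (by fun_prop)).aestronglyMeasurable
  · filter_upwards [ae_restrict_mem measurableSet_Ioi] with t (ht : 0 < t)
    have h := hC k t (by simp)
    rw [norm_real, Real.norm_of_nonneg ht.le] at h
    rw [norm_mul, norm_cexp_neg_mul]
    calc ‖f (t / r k)‖ * Real.exp (-(p.re * t))
      _ ≤ C * t ^ n * (r k ^ n)⁻¹ * Real.exp (-(p.re * t)) := by gcongr
      _ = _ := by ring
  · simp only [tsum_mul_right]
    exact ((integrableOn_pow_mul_exp_neg_mul n hp).const_mul C).const_mul _

theorem continuousOn_ray (hf : IsUpperRegular n f) {d : ℂ} (hd : 0 ≤ d.im) :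
    ContinuousOn (fun s : ℝ => f (d * s)) (Set.Ici 0) :=
  hf.continuousOn.comp (by fun_prop) fun s hs => by simpa using mul_nonneg hd hs

end IsUpperRegular

/-! ### Rotation of the ray of integration -/

/-- The Laplace integral of `f` along the ray with direction `d`. -/
def rayLaplace (f : ℂ → ℂ) (p d : ℂ) : ℂ :=
  d * ∫ s in Set.Ioi (0 : ℝ), f (d * s) * cexp (-(p * d * s))

/-- The directions in the closed upper half-plane along which `exp (-p t)` decays. -/
def rayDomain (p : ℂ) : Set ℂ := {d | 0 ≤ d.im ∧ 0 < (p * d).re}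

theorem rayLaplace_ofReal_mul (f : ℂ → ℂ) (p d : ℂ) {l : ℝ} (hl : 0 < l) :
    rayLaplace f p (l * d) = rayLaplace f p d := by
  have h := integral_comp_mul_left_Ioi' (fun s : ℝ => f (d * s) * cexp (-(p * d * s))) 0 hl
  rw [mul_zero] at h
  rw [rayLaplace, rayLaplace, ← h, real_smul, mul_comm (l : ℂ) d, mul_assoc]
  simp only [ofReal_mul, mul_assoc, mul_left_comm p]

theorem isOpen_setOf_lt_re_mul_and_norm_lt (p : ℂ) (c M : ℝ) :
    IsOpen {d : ℂ | c < (p * d).re ∧ ‖d‖ < M} :=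
  (isOpen_lt (g := fun d : ℂ => (p * d).re) continuous_const (by fun_prop)).inter
    (isOpen_lt continuous_norm continuous_const)

theorem isOpen_interior_rayDomain (p : ℂ) : IsOpen ({d | 0 < d.im} ∩ rayDomain p) := by
  have : {d : ℂ | 0 < d.im} ∩ rayDomain p = {d | 0 < d.im ∧ 0 < (p * d).re} :=
    Set.ext fun d => ⟨fun h => ⟨h.1, h.2.2⟩, fun h => ⟨h.1, h.1.le, h.2⟩⟩
  rw [this]
  exact (isOpen_lt continuous_const continuous_im).inter
    (isOpen_lt (g := fun d : ℂ => (p * d).re) continuous_const (by fun_prop))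

theorem convex_interior_rayDomain (p : ℂ) : Convex ℝ ({d | 0 < d.im} ∩ rayDomain p) :=
  (convex_halfSpace_im_gt 0).inter <| (convex_halfSpace_im_ge 0).inter <|
    convex_halfSpace_gt (f := fun d : ℂ => (p * d).re) ⟨fun x y => by simp only [mul_add, add_re],
      fun c x => by simp only [real_smul, mul_left_comm p, re_ofReal_mul, smul_eq_mul]⟩ 0

theorem rayDomain_subset_closure (p : ℂ) :
    rayDomain p ⊆ closure ({d | 0 < d.im} ∩ rayDomain p) := by
  intro d hd
  have hlim : Tendsto (fun ε : ℝ => d + ε * I) (𝓝[>] 0) (𝓝 d) := by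
    have : Continuous fun ε : ℝ => d + ε * I := by fun_prop
    simpa using (this.tendsto 0).mono_left nhdsWithin_le_nhds
  refine mem_closure_of_tendsto hlim ?_
  have hre : ∀ᶠ e in 𝓝 d, 0 < (p * e).re :=
    (isOpen_lt (g := fun d : ℂ => (p * d).re) continuous_const (by fun_prop)).mem_nhds hd.2
  filter_upwards [hlim.eventually hre, self_mem_nhdsWithin] with ε hε hε0
  have him : 0 < (d + ε * I).im := by simpa using add_pos_of_nonneg_of_pos hd.1 hε0
  exact ⟨him, him.le, hε⟩

namespace IsUpperRegular

variable {n : ℕ} {f : ℂ → ℂ} {p d : ℂ}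

theorem aestronglyMeasurable_ray (hf : IsUpperRegular n f) (hd : 0 ≤ d.im) (q : ℂ) :
    AEStronglyMeasurable (fun s : ℝ => f (d * s) * cexp (-(q * s)))
      (volume.restrict (Set.Ioi 0)) :=
  (((hf.continuousOn_ray hd).mono Set.Ioi_subset_Ici_self).mul
    (by fun_prop)).aestronglyMeasurable measurableSet_Ioi

theorem exists_nhds_dominated (hf : IsUpperRegular n f) (hd : 0 < (p * d).re) :
    ∃ U ∈ 𝓝 d, ∃ b : ℝ → ℝ, IntegrableOn b (Set.Ioi 0) ∧ ∀ s : ℝ, 0 < s → ∀ z ∈ U, 0 ≤ z.im →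
      ‖f (z * s) * cexp (-(p * z * s))‖ ≤ b s := by
  obtain ⟨C, hC0, hC⟩ := hf.exists_nonneg_norm_le
  refine ⟨_, (isOpen_setOf_lt_re_mul_and_norm_lt p ((p * d).re / 2) (‖d‖ + 1)).mem_nhds
    ⟨half_lt_self hd, lt_add_one _⟩, _,
    (integrableOn_pow_mul_exp_neg_mul n (half_pos hd)).const_mul (C * (‖d‖ + 1) ^ n), ?_⟩
  rintro s hs z ⟨hzre, hznorm⟩ hzim
  refine norm_mul_cexp_le (f := fun s => f (z * s)) (fun t ht => ?_) hzre.le hs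
  calc ‖f (z * t)‖ ≤ C * ‖z * t‖ ^ n := hC _ (by simpa using mul_nonneg hzim ht.le)
    _ = C * ‖z‖ ^ n * t ^ n := by
      rw [norm_mul, norm_real, Real.norm_of_nonneg ht.le, mul_pow, mul_assoc]
    _ ≤ C * (‖d‖ + 1) ^ n * t ^ n := by gcongr

theorem differentiableAt_rayLaplace (hf : IsUpperRegular n f)
    (hd : d ∈ {d | 0 < d.im} ∩ rayDomain p) : DifferentiableAt ℂ (rayLaplace f p) d := by
  obtain ⟨U, hU, b, hb, hbound⟩ := hf.exists_nhds_dominated hd.2.2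
  have him : {z : ℂ | 0 < z.im} ∈ 𝓝 d := (isOpen_lt continuous_const continuous_im).mem_nhds hd.1
  refine differentiableAt_id.mul (differentiableAt_integral_of_dominated (inter_mem hU him) hb
    (fun z hz => hf.aestronglyMeasurable_ray (le_of_lt hz.2) _) ?_ ?_)
  · filter_upwards [ae_restrict_mem measurableSet_Ioi] with s hs
    refine DifferentiableOn.mul (hf.differentiableOn.comp (by fun_prop) fun z hz => ?_)
      (by fun_prop)
    simpa using mul_pos hz.2 hs
  · filter_upwards [ae_restrict_mem measurableSet_Ioi] with s hs z hz
    exact hbound s hs z hz.1 (le_of_lt hz.2)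

theorem continuousOn_rayLaplace (hf : IsUpperRegular n f) :
    ContinuousOn (rayLaplace f p) (rayDomain p) := by
  intro d hd
  obtain ⟨U, hU, b, hb, hbound⟩ := hf.exists_nhds_dominated hd.2
  refine continuousWithinAt_id.mul (continuousWithinAt_of_dominated (bound := b) ?_ ?_ hb ?_)
  · filter_upwards [self_mem_nhdsWithin] with z hz using hf.aestronglyMeasurable_ray hz.1 _
  · filter_upwards [self_mem_nhdsWithin, mem_nhdsWithin_of_mem_nhds hU] with z hz hzU
    filter_upwards [ae_restrict_mem measurableSet_Ioi] with s hs using hbound s hs z hzU hz.1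
  · filter_upwards [ae_restrict_mem measurableSet_Ioi] with s hs
    have hray : ContinuousOn (fun z : ℂ => f (z * s)) (rayDomain p) :=
      hf.continuousOn.comp (by fun_prop) fun z hz => by
        simpa using mul_nonneg hz.1 (le_of_lt hs)
    exact (hray.mul (by fun_prop)) d hd

/- The Laplace integral is invariant under real dilations of the direction, so its complex
derivative in the direction vanishes. -/
theorem deriv_rayLaplace (hf : IsUpperRegular n f) (hd : d ∈ {d | 0 < d.im} ∩ rayDomain p) :
    deriv (rayLaplace f p) d = 0 := by
  have hd0 : d ≠ 0 := by
    rintro rfl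
    simp at hd
  have hdil : HasDerivAt (fun t : ℝ => (t : ℂ) * d) d 1 := by
    simpa using (hasDerivAt_id (1 : ℝ)).ofReal_comp.mul_const d
  have hderiv : HasDerivAt (rayLaplace f p) (deriv (rayLaplace f p) d) (((1 : ℝ) : ℂ) * d) := by
    rw [ofReal_one, one_mul]
    exact (hf.differentiableAt_rayLaplace hd).hasDerivAt
  have hcomp : HasDerivAt (fun t : ℝ => rayLaplace f p (t * d)) (deriv (rayLaplace f p) d * d) 1 :=
    HasDerivAt.comp (h := fun t : ℝ => (t : ℂ) * d) (1 : ℝ) hderiv hdil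
  have hconst : (fun t : ℝ => rayLaplace f p (t * d)) =ᶠ[𝓝 1] fun _ => rayLaplace f p d := by
    filter_upwards [lt_mem_nhds one_pos] with t ht using rayLaplace_ofReal_mul f p d ht
  have := hcomp.unique ((hasDerivAt_const 1 _).congr_of_eventuallyEq hconst)
  simpa [hd0] using this

theorem rayLaplace_eq_rayLaplace (hf : IsUpperRegular n f) {e : ℂ} (hd : d ∈ rayDomain p)
    (he : e ∈ rayDomain p) : rayLaplace f p d = rayLaplace f p e := by
  obtain ⟨c, hc⟩ : ∃ c, ∀ x ∈ {d | 0 < d.im} ∩ rayDomain p, rayLaplace f p x = c :=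
    (isOpen_interior_rayDomain p).exists_is_const_of_deriv_eq_zero
      (convex_interior_rayDomain p).isPreconnected
      (fun x hx => (hf.differentiableAt_rayLaplace hx).differentiableWithinAt)
      fun x hx => hf.deriv_rayLaplace hx
  have hconst : Set.EqOn (rayLaplace f p) (fun _ => c) (rayDomain p) :=
    Set.EqOn.of_subset_closure hc hf.continuousOn_rayLaplace continuousOn_const
      Set.inter_subset_right (rayDomain_subset_closure p)
  exact (hconst hd).trans (hconst he).symm

theorem integral_ray_eq (hf : IsUpperRegular n f) (hp : 0 < p.re) (hd : d ∈ rayDomain p) :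
    d * ∫ s in Set.Ioi (0 : ℝ), f (d * s) * cexp (-(p * d * s)) =
      ∫ s in Set.Ioi (0 : ℝ), f s * cexp (-(p * s)) := by
  have h := hf.rayLaplace_eq_rayLaplace hd (e := 1) ⟨by simp, by simpa using hp⟩
  simpa [rayLaplace] using h

end IsUpperRegular

/-! ### The kernel -/

/-- The branch of `log (1 - u)` that is continuous on the closed upper half-plane without `1`. -/
def logOneSub (u : ℂ) : ℂ := conj (log (1 - conj u))

/-- The function with third derivative `u / (1 - u ^ 2)` that vanishes to fourth order at `0`. The
Borel transform of the perturbation series is a superposition of its dilations. -/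
def kernel (u : ℂ) : ℂ :=
  -(1 / 4) * ((1 - u) ^ 2 * logOneSub u + (1 + u) ^ 2 * log (1 + u)) + 3 / 4 * u ^ 2

/-- The first derivative of `kernel`. -/
def kernel₁ (u : ℂ) : ℂ :=
  1 / 2 * ((1 - u) * logOneSub u - (1 + u) * log (1 + u)) + u

/-- The second derivative of `kernel`. -/
def kernel₂ (u : ℂ) : ℂ := -(1 / 2) * (logOneSub u + log (1 + u))

/-- The third derivative of `kernel`. -/
def kernel₃ (u : ℂ) : ℂ := u / (1 - u ^ 2)

/-- The fourth derivative of `kernel`. -/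
def kernel₄ (u : ℂ) : ℂ := (1 + u ^ 2) / (1 - u ^ 2) ^ 2

/-- The Taylor coefficients of `kernel` at `0`; the first nonzero one is that of `u ^ 4`, because
of the junk value `0⁻¹ = 0`. -/
def kernelCoeff (k : ℕ) : ℝ := if Even k then ((k : ℝ) * (k - 1) * (k - 2))⁻¹ else 0

/-- The plane cut along the real half-lines `(-∞, -1]` and `[1, ∞)`, on which `kernel` is
holomorphic. -/
def kernelDomain : Set ℂ := {u | 1 - u ∈ slitPlane ∧ 1 + u ∈ slitPlane}

theorem mem_kernelDomain_of_im_ne_zero {u : ℂ} (hu : u.im ≠ 0) : u ∈ kernelDomain :=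
  ⟨.inr (by simpa using hu), .inr (by simpa using hu)⟩

theorem mem_kernelDomain_of_norm_lt_one {u : ℂ} (hu : ‖u‖ < 1) : u ∈ kernelDomain :=
  ⟨by simpa [sub_eq_add_neg] using mem_slitPlane_of_norm_lt_one (z := -u) (by simpa using hu),
    mem_slitPlane_of_norm_lt_one hu⟩

theorem mul_ofReal_mem_kernelDomain {d : ℂ} (hd : d.im ≠ 0) (s : ℝ) : d * s ∈ kernelDomain := by
  rcases eq_or_ne s 0 with rfl | hs
  · exact mem_kernelDomain_of_norm_lt_one (by simp)
  · exact mem_kernelDomain_of_im_ne_zero (by simpa using ⟨hd, hs⟩)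

theorem logOneSub_eq {u : ℂ} (hu : 1 - u ∈ slitPlane) : logOneSub u = log (1 - u) := by
  have h := log_conj (1 - u) (slitPlane_arg_ne_pi hu)
  rw [logOneSub, ← conj_conj (log (1 - u)), ← h, map_sub, map_one]

theorem hasDerivAt_logOneSub {u : ℂ} (hu : u ∈ kernelDomain) :
    HasDerivAt logOneSub (-(1 - u)⁻¹) u := by
  have hlog : HasDerivAt (fun u => log (1 - u)) (-(1 - u)⁻¹) u := by
    simpa [neg_div] using ((hasDerivAt_id u).const_sub 1).clog hu.1
  have hnear : ∀ᶠ v in 𝓝 u, 1 - v ∈ slitPlane :=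
    (continuous_sub_left 1).continuousAt.eventually_mem (isOpen_slitPlane.mem_nhds hu.1)
  exact hlog.congr_of_eventuallyEq (hnear.mono fun v hv => logOneSub_eq hv)

theorem hasDerivAt_log_one_add {u : ℂ} (hu : u ∈ kernelDomain) :
    HasDerivAt (fun u : ℂ => log (1 + u)) ((1 + u)⁻¹) u := by
  simpa using ((hasDerivAt_id u).const_add 1).clog hu.2

theorem one_sub_ne_zero {u : ℂ} (hu : u ∈ kernelDomain) : 1 - u ≠ 0 := slitPlane_ne_zero hu.1

theorem one_add_ne_zero {u : ℂ} (hu : u ∈ kernelDomain) : 1 + u ≠ 0 := slitPlane_ne_zero hu.2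

theorem one_sub_sq_ne_zero {u : ℂ} (hu : u ∈ kernelDomain) : 1 - u ^ 2 ≠ 0 := by
  rw [← one_pow 2, sq_sub_sq]
  exact mul_ne_zero (one_add_ne_zero hu) (one_sub_ne_zero hu)

theorem hasDerivAt_kernel {u : ℂ} (hu : u ∈ kernelDomain) : HasDerivAt kernel (kernel₁ u) u := by
  have hsub := ((hasDerivAt_id' u).const_sub 1).fun_pow 2
  have hadd := ((hasDerivAt_id' u).const_add 1).fun_pow 2
  refine ((((hsub.fun_mul (hasDerivAt_logOneSub hu)).fun_add
    (hadd.fun_mul (hasDerivAt_log_one_add hu))).const_mul (-(1 / 4))).fun_add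
    (((hasDerivAt_id' u).fun_pow 2).const_mul (3 / 4))).congr_deriv ?_
  have := one_sub_ne_zero hu
  have := one_add_ne_zero hu
  rw [kernel₁]
  field_simp
  ring

theorem hasDerivAt_kernel₁ {u : ℂ} (hu : u ∈ kernelDomain) : HasDerivAt kernel₁ (kernel₂ u) u := by
  have hsub := (hasDerivAt_id' u).const_sub 1
  have hadd := (hasDerivAt_id' u).const_add 1
  refine ((((hsub.fun_mul (hasDerivAt_logOneSub hu)).fun_sub
    (hadd.fun_mul (hasDerivAt_log_one_add hu))).const_mul (1 / 2)).fun_add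
    (hasDerivAt_id' u)).congr_deriv ?_
  have := one_sub_ne_zero hu
  have := one_add_ne_zero hu
  rw [kernel₂]
  field_simp
  ring

theorem hasDerivAt_kernel₂ {u : ℂ} (hu : u ∈ kernelDomain) : HasDerivAt kernel₂ (kernel₃ u) u := by
  refine (((hasDerivAt_logOneSub hu).fun_add
    (hasDerivAt_log_one_add hu)).const_mul (-(1 / 2))).congr_deriv ?_
  have := one_sub_ne_zero hu
  have := one_add_ne_zero hu
  have := one_sub_sq_ne_zero hu
  rw [kernel₃]
  field_simp
  ring

theorem hasDerivAt_kernel₃ {u : ℂ} (hu : u ∈ kernelDomain) : HasDerivAt kernel₃ (kernel₄ u) u := by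
  refine ((hasDerivAt_id' u).fun_div (((hasDerivAt_id' u).fun_pow 2).const_sub 1)
    (one_sub_sq_ne_zero hu)).congr_deriv ?_
  rw [kernel₄]
  ring

theorem continuousOn_kernel₄ : ContinuousOn kernel₄ kernelDomain :=
  ContinuousOn.div (by fun_prop) (by fun_prop) fun _ hu => pow_ne_zero 2 (one_sub_sq_ne_zero hu)

theorem logOneSub_zero : logOneSub 0 = 0 := by simp [logOneSub]

theorem kernel_zero : kernel 0 = 0 := by simp [kernel, logOneSub_zero]

theorem kernel₁_zero : kernel₁ 0 = 0 := by simp [kernel₁, logOneSub_zero]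

theorem kernel₂_zero : kernel₂ 0 = 0 := by simp [kernel₂, logOneSub_zero]

theorem kernel₃_zero : kernel₃ 0 = 0 := by simp [kernel₃]

theorem norm_log_le (z : ℂ) : ‖log z‖ ≤ |Real.log ‖z‖| + Real.pi := by
  refine (Complex.norm_le_abs_re_add_abs_im _).trans ?_
  rw [log_re, log_im]
  gcongr
  exact abs_arg_le_pi z

theorem isBigO_log_cobounded : log =O[Bornology.cobounded ℂ] fun z => z := by
  refine .of_bound (1 + Real.pi) ?_
  filter_upwards [eventually_cobounded_le_norm 1] with z hz
  rw [add_mul, one_mul]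
  refine (norm_log_le z).trans (add_le_add ?_ (le_mul_of_one_le_right Real.pi_pos.le hz))
  rw [abs_of_nonneg (Real.log_nonneg hz)]
  exact Real.log_le_self (norm_nonneg z)

theorem isBigO_one_cobounded : (fun _ : ℂ => (1 : ℂ)) =O[Bornology.cobounded ℂ] fun u => u :=
  (isLittleO_const_id_cobounded 1).isBigO

theorem isBigO_one_add_cobounded : (fun u : ℂ => 1 + u) =O[Bornology.cobounded ℂ] fun u => u :=
  isBigO_one_cobounded.add (isBigO_refl _ _)

theorem isBigO_one_sub_cobounded : (fun u : ℂ => 1 - u) =O[Bornology.cobounded ℂ] fun u => u :=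
  isBigO_one_cobounded.sub (isBigO_refl _ _)

theorem isBigO_log_one_add : (fun u => log (1 + u)) =O[Bornology.cobounded ℂ] fun u => u :=
  (isBigO_log_cobounded.comp_tendsto (tendsto_const_add_cobounded 1)).trans isBigO_one_add_cobounded

theorem isBigO_logOneSub : logOneSub =O[Bornology.cobounded ℂ] fun u => u := by
  have hconj : Tendsto (conj : ℂ → ℂ) (Bornology.cobounded ℂ) (Bornology.cobounded ℂ) := by
    simpa [← tendsto_norm_atTop_iff_cobounded] using tendsto_norm_cobounded_atTop (E := ℂ)
  have hlog := (isBigO_log_cobounded.comp_tendsto (tendsto_const_sub_cobounded 1)).trans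
    isBigO_one_sub_cobounded
  refine .of_norm_norm ?_
  simpa [logOneSub, Function.comp_def] using (hlog.comp_tendsto hconj).norm_norm

theorem isBigO_kernel : kernel =O[Bornology.cobounded ℂ] fun u => u ^ 3 := by
  refine ((((isBigO_one_sub_cobounded.pow 2).mul isBigO_logOneSub).add
    ((isBigO_one_add_cobounded.pow 2).mul isBigO_log_one_add)).const_mul_left _).add ?_
    |>.congr_right fun u => (pow_succ u 2).symm
  simpa using ((isBigO_refl (fun u : ℂ => u ^ 2) _).mul isBigO_one_cobounded).const_mul_left (3 / 4)

theorem isBigO_kernel₁ : kernel₁ =O[Bornology.cobounded ℂ] fun u => u ^ 2 := by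
  refine (((isBigO_one_sub_cobounded.mul isBigO_logOneSub).sub
    (isBigO_one_add_cobounded.mul isBigO_log_one_add)).const_mul_left _).add ?_
    |>.congr_right fun u => (sq u).symm
  simpa using (isBigO_refl (fun u : ℂ => u) _).mul isBigO_one_cobounded

theorem isBigO_kernel₂ : kernel₂ =O[Bornology.cobounded ℂ] fun u => u ^ 1 := by
  simp only [pow_one]
  exact (isBigO_logOneSub.add isBigO_log_one_add).const_mul_left _

theorem norm_sq_le_norm_one_sub_sq (u : ℂ) : ‖u‖ ^ 2 - 1 ≤ ‖1 - u ^ 2‖ := by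
  rw [← norm_pow, ← norm_one (α := ℂ), norm_sub_rev]
  exact norm_sub_norm_le (u ^ 2) 1

theorem isBigO_kernel₃ : kernel₃ =O[Bornology.cobounded ℂ] fun u => u ^ 0 := by
  refine .of_bound 1 ?_
  filter_upwards [eventually_cobounded_le_norm 2] with u hu
  have := norm_sq_le_norm_one_sub_sq u
  rw [kernel₃, norm_div, pow_zero, norm_one, mul_one]
  exact div_le_one_of_le₀ (by nlinarith) (norm_nonneg _)

theorem isBigO_kernel₄ : kernel₄ =O[Bornology.cobounded ℂ] fun u => u ^ 0 := by
  refine .of_bound 1 ?_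
  filter_upwards [eventually_cobounded_le_norm 2] with u hu
  have := norm_sq_le_norm_one_sub_sq u
  have hadd : ‖1 + u ^ 2‖ ≤ 1 + ‖u‖ ^ 2 := by
    rw [← norm_pow, ← norm_one (α := ℂ)]
    exact norm_add_le 1 (u ^ 2)
  rw [kernel₄, norm_div, norm_pow, pow_zero, norm_one, mul_one]
  exact div_le_one_of_le₀ (by nlinarith [mul_self_le_mul_self two_pos.le hu]) (by positivity)

theorem continuousOn_mul_log : ContinuousOn (fun z : ℂ => z * log z) {z | 0 ≤ z.im} := by
  intro z hz
  by_cases hslit : z ∈ slitPlane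
  · exact (continuousAt_id.mul (continuousAt_clog hslit)).continuousWithinAt
  · obtain ⟨hre, him⟩ := (not_iff_not.2 mem_slitPlane_iff).1 hslit |> not_or.1
    rw [not_lt] at hre
    rw [not_not] at him
    rcases hre.lt_or_eq with hre | hre
    · exact continuousWithinAt_id.mul (continuousWithinAt_log_of_re_neg_of_im_zero hre him)
    obtain rfl : z = 0 := Complex.ext hre him
    refine ContinuousAt.continuousWithinAt ?_
    rw [ContinuousAt, zero_mul]
    refine squeeze_zero_norm (a := fun z : ℂ => |‖z‖ * Real.log ‖z‖| + ‖z‖ * Real.pi)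
      (fun z => ?_) ?_
    · rw [norm_mul, abs_mul, abs_norm, ← mul_add]
      exact mul_le_mul_of_nonneg_left (norm_log_le z) (norm_nonneg z)
    · have : Continuous fun z : ℂ => |‖z‖ * Real.log ‖z‖| + ‖z‖ * Real.pi :=
        (Real.continuous_mul_log.comp continuous_norm).abs.add (by fun_prop)
      simpa using this.tendsto 0

theorem continuousOn_kernel : ContinuousOn kernel {u | 0 ≤ u.im} := by
  have hadd : ContinuousOn (fun u : ℂ => (1 + u) * log (1 + u)) {u | 0 ≤ u.im} :=
    continuousOn_mul_log.comp (f := fun u : ℂ => 1 + u) (by fun_prop) fun u hu => by simpa using hu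
  have hsub : ContinuousOn (fun u : ℂ => (1 - u) * logOneSub u) {u | 0 ≤ u.im} := by
    have h := continuousOn_mul_log.comp (f := fun u : ℂ => 1 - conj u)
      (s := {u | 0 ≤ u.im}) (by fun_prop) fun u hu => by simpa using hu
    simpa [logOneSub, Function.comp_def] using continuous_conj.comp_continuousOn h
  have h : ContinuousOn (fun u : ℂ => -(1 / 4) * ((1 - u) * ((1 - u) * logOneSub u) +
      (1 + u) * ((1 + u) * log (1 + u))) + 3 / 4 * u ^ 2) {u | 0 ≤ u.im} := by
    fun_prop
  exact h.congr fun u _ => by simp only [kernel, sq, mul_assoc]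

theorem kernelCoeff_eq_zero {k : ℕ} (hk : k < 4) : kernelCoeff k = 0 := by
  interval_cases k <;> simp [kernelCoeff, Nat.even_iff]

theorem kernelCoeff_nonneg (k : ℕ) : 0 ≤ kernelCoeff k := by
  rcases lt_or_ge k 4 with hk | hk
  · exact (kernelCoeff_eq_zero hk).ge
  · have : (4 : ℝ) ≤ k := mod_cast hk
    rw [kernelCoeff]
    split_ifs
    · exact inv_nonneg.2 (mul_nonneg (mul_nonneg (by linarith) (by linarith)) (by linarith))
    · rfl

theorem hasSum_one_sub_sq_mul_log {v : ℂ} (hv : ‖v‖ < 1) :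
    HasSum (fun k : ℕ => v ^ (k + 3) *
      (((k : ℂ) + 3)⁻¹ - 2 * ((k : ℂ) + 2)⁻¹ + ((k : ℂ) + 1)⁻¹))
      ((1 - v) ^ 2 * (-log (1 - v)) - v + 3 / 2 * v ^ 2) := by
  have h0 := hasSum_taylorSeries_neg_log' hv
  have h1 := (hasSum_nat_add_iff' 1).2 h0
  have h2 := (hasSum_nat_add_iff' 2).2 h0
  convert! (h2.add (h1.mul_left (-2 * v))).add (h0.mul_left (v ^ 2)) using 1
  · ext k
    push_cast
    rw [add_assoc (k : ℂ) 2, add_assoc (k : ℂ) 1]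
    norm_num
    ring
  · simp [Finset.sum_range_succ]
    ring

theorem hasSum_kernel {u : ℂ} (hu : ‖u‖ < 1) :
    HasSum (fun k : ℕ => (kernelCoeff k : ℂ) * u ^ k) (kernel u) := by
  have hneg := hasSum_one_sub_sq_mul_log (v := -u) (by simpa using hu)
  rw [← hasSum_nat_add_iff' 3]
  convert! ((hasSum_one_sub_sq_mul_log hu).add hneg).mul_left (1 / 4) using 1
  · ext k
    have h3 : (k : ℂ) + 3 ≠ 0 := mod_cast (k + 2).succ_ne_zero
    have h2 : (k : ℂ) + 2 ≠ 0 := mod_cast (k + 1).succ_ne_zero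
    have h1 : (k : ℂ) + 1 ≠ 0 := mod_cast k.succ_ne_zero
    rw [neg_pow u, kernelCoeff]
    split_ifs with hk
    · rw [hk.neg_one_pow]
      push_cast
      rw [add_sub_assoc (k : ℂ) 3 1, add_sub_assoc (k : ℂ) 3 2]
      norm_num
      field_simp
      ring
    · rw [(Nat.not_even_iff_odd.1 hk).neg_one_pow]
      push_cast
      ring
  · rw [Finset.sum_eq_zero fun k hk => by
      rw [kernelCoeff_eq_zero ((Finset.mem_range.1 hk).trans (by norm_num)), ofReal_zero, zero_mul],
      kernel, logOneSub_eq (mem_kernelDomain_of_norm_lt_one hu).1]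
    ring_nf

theorem isUpperRegular_kernel_sub_sum {M : ℕ} (hM : 4 ≤ M) :
    IsUpperRegular M fun u => kernel u - ∑ k ∈ Finset.range M, (kernelCoeff k : ℂ) * u ^ k where
  differentiableOn u hu :=
    ((hasDerivAt_kernel (mem_kernelDomain_of_im_ne_zero (ne_of_gt hu))).differentiableAt.sub
      (by fun_prop)).differentiableWithinAt
  continuousOn := continuousOn_kernel.sub (by fun_prop)
  exists_norm_le := by
    have hzero : (fun u => kernel u - ∑ k ∈ Finset.range M, (kernelCoeff k : ℂ) * u ^ k)
        =O[𝓝 0] fun u => u ^ M := by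
      have h := (hasFPowerSeriesOnBall_ofScalars_of_hasSum one_pos
        fun z => hasSum_kernel).hasFPowerSeriesAt.isBigO_sub_partialSum_pow M
      simpa [FormalMultilinearSeries.partialSum, FormalMultilinearSeries.ofScalars_apply_eq,
        mul_comm, ← norm_pow] using h
    have hinfty : (fun u => kernel u - ∑ k ∈ Finset.range M, (kernelCoeff k : ℂ) * u ^ k)
        =O[Bornology.cobounded ℂ] fun u => u ^ M :=
      (isBigO_kernel.trans (isBigO_pow_pow_cobounded_of_le (by omega))).sub <|
        .fun_sum fun k hk => (isBigO_pow_pow_cobounded_of_le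
          (Finset.mem_range.1 hk).le).const_mul_left _
    obtain ⟨C, hC⟩ := exists_norm_le_of_isBigO
      (isClosed_le continuous_const continuous_im : IsClosed {u : ℂ | 0 ≤ u.im})
      (continuousOn_kernel.sub (by fun_prop)) (by fun_prop)
      (fun u _ hu => pow_ne_zero M hu) hzero hinfty
    exact ⟨C, fun u hu => by simpa [norm_pow] using hC u hu⟩

theorem isUpperRegular_kernel : IsUpperRegular 4 kernel := by
  have h := isUpperRegular_kernel_sub_sum le_rfl
  rwa [show (fun u => kernel u - ∑ k ∈ Finset.range 4, (kernelCoeff k : ℂ) * u ^ k) = kernel from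
    funext fun u => sub_eq_self.2 <| Finset.sum_eq_zero fun k hk => by
      rw [kernelCoeff_eq_zero (Finset.mem_range.1 hk), ofReal_zero, zero_mul]] at h

/-! ### Oscillating integrals -/

theorem isBigO_comp_mul_ofReal {F : ℂ → ℂ} {m : ℕ}
    (hF : F =O[Bornology.cobounded ℂ] fun u => u ^ m) {d : ℂ} (hd : d ≠ 0) :
    (fun s : ℝ => F (d * s)) =O[atTop] fun s : ℝ => s ^ m := by
  have hray : Tendsto (fun s : ℝ => d * (s : ℂ)) atTop (Bornology.cobounded ℂ) :=
    (tendsto_mul_left_cobounded hd).comp (RCLike.tendsto_ofReal_atTop_cobounded ℂ)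
  refine (hF.comp_tendsto hray).trans (.of_bound (‖d‖ ^ m) (.of_forall fun s => ?_))
  simp [mul_pow]

theorem hasDerivAt_comp_mul_ofReal {F : ℂ → ℂ} {F' d : ℂ} {s : ℝ} (hF : HasDerivAt F F' (d * s)) :
    HasDerivAt (fun s : ℝ => F (d * s)) (d * F') s := by
  have hray : HasDerivAt (fun s : ℝ => d * (s : ℂ)) d s := by
    simpa using (hasDerivAt_id s).ofReal_comp.const_mul d
  simpa [mul_comm, Function.comp_def] using hF.comp s hray

section Ray

variable {d : ℂ} (hd : 0 < d.im)
include hd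

theorem mul_integral_ray_eq {F F' : ℂ → ℂ} {m m' : ℕ}
    (hF : ∀ u ∈ kernelDomain, HasDerivAt F (F' u) u) (hF0 : F 0 = 0)
    (hFO : F =O[Bornology.cobounded ℂ] fun u => u ^ m)
    (hF'O : F' =O[Bornology.cobounded ℂ] fun u => u ^ m') (hF' : ContinuousOn F' kernelDomain)
    {q : ℂ} (hq : 0 < q.re) :
    q * ∫ s in Set.Ioi (0 : ℝ), F (d * s) * cexp (-(q * s)) =
      d * ∫ s in Set.Ioi (0 : ℝ), F' (d * s) * cexp (-(q * s)) := by
  have hd0 : d ≠ 0 := by rintro rfl; simp at hd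
  have hderiv (s : ℝ) : HasDerivAt (fun s : ℝ => F (d * s)) (d * F' (d * s)) s :=
    hasDerivAt_comp_mul_ofReal (hF _ (mul_ofReal_mem_kernelDomain hd.ne' s))
  have hint := (integrableOn_mul_cexp_of_isBigO
    (hF'.comp_continuous (by fun_prop) (mul_ofReal_mem_kernelDomain hd.ne')).continuousOn
    (isBigO_comp_mul_ofReal hF'O hd0) hq).const_mul d
  have h := mul_integral_mul_cexp_eq hq (fun s _ => (hderiv s).continuousAt.continuousWithinAt)
    (fun s _ => hderiv s) (isBigO_comp_mul_ofReal hFO hd0)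
    (by simpa only [mul_assoc, IntegrableOn] using! hint)
  simpa only [ofReal_zero, mul_zero, hF0, zero_add, mul_assoc, integral_const_mul] using h

theorem pow_mul_integral_kernel_eq {q : ℂ} (hq : 0 < q.re) :
    q ^ 4 * ∫ s in Set.Ioi (0 : ℝ), kernel (d * s) * cexp (-(q * s)) =
      d ^ 4 * ∫ s in Set.Ioi (0 : ℝ), kernel₄ (d * s) * cexp (-(q * s)) := by
  have h₁ := mul_integral_ray_eq hd (fun _ => hasDerivAt_kernel) kernel_zero isBigO_kernel
    isBigO_kernel₁ (fun _ hu => (hasDerivAt_kernel₁ hu).continuousAt.continuousWithinAt) hq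
  have h₂ := mul_integral_ray_eq hd (fun _ => hasDerivAt_kernel₁) kernel₁_zero isBigO_kernel₁
    isBigO_kernel₂ (fun _ hu => (hasDerivAt_kernel₂ hu).continuousAt.continuousWithinAt) hq
  have h₃ := mul_integral_ray_eq hd (fun _ => hasDerivAt_kernel₂) kernel₂_zero isBigO_kernel₂
    isBigO_kernel₃ (fun _ hu => (hasDerivAt_kernel₃ hu).continuousAt.continuousWithinAt) hq
  have h₄ := mul_integral_ray_eq hd (fun _ => hasDerivAt_kernel₃) kernel₃_zero isBigO_kernel₃
    isBigO_kernel₄ continuousOn_kernel₄ hq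
  linear_combination q ^ 3 * h₁ + q ^ 2 * d * h₂ + q * d ^ 2 * h₃ + d ^ 3 * h₄

theorem norm_inv_one_sub_sq_le (s : ℝ) :
    ‖1 - (d * s) ^ 2‖⁻¹ ≤ ‖d‖ / d.im * (1 + (‖d‖ * s) ^ 2)⁻¹ := by
  have him : (((d * s) ^ 2 - 1) * conj d).im = d.im * (1 + (‖d‖ * s) ^ 2) := by
    rw [mul_pow ‖d‖, Complex.sq_norm, normSq_apply]
    simp [sq]
    ring
  have h : d.im * (1 + (‖d‖ * s) ^ 2) ≤ ‖d‖ * ‖1 - (d * s) ^ 2‖ := by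
    rw [← him, norm_sub_rev, mul_comm, ← norm_conj d, ← norm_mul]
    exact im_le_norm _
  have hpos : 0 < ‖1 - (d * s) ^ 2‖ :=
    norm_pos_iff.2 (one_sub_sq_ne_zero (mul_ofReal_mem_kernelDomain hd.ne' s))
  rw [div_mul_eq_mul_div, ← div_eq_mul_inv, div_div, le_div_iff₀ (by positivity),
    inv_mul_le_iff₀ hpos]
  linarith

theorem norm_kernel₃_ray_le (s : ℝ) :
    ‖kernel₃ (d * s)‖ ≤ ‖d‖ / d.im * (‖d‖ * |s| * (1 + (‖d‖ * s) ^ 2)⁻¹) := by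
  rw [kernel₃, div_eq_mul_inv, norm_mul, norm_inv, norm_mul, norm_real, Real.norm_eq_abs,
    mul_left_comm]
  gcongr
  exact norm_inv_one_sub_sq_le hd s

theorem norm_kernel₄_ray_le (s : ℝ) :
    ‖kernel₄ (d * s)‖ ≤ (‖d‖ / d.im) ^ 2 * (1 + (‖d‖ * s) ^ 2)⁻¹ := by
  have hnum : ‖1 + (d * s) ^ 2‖ ≤ 1 + (‖d‖ * s) ^ 2 := by
    refine (norm_add_le _ _).trans_eq ?_
    rw [norm_one, norm_pow, norm_mul, norm_real, mul_pow, mul_pow, Real.norm_eq_abs, sq_abs]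
  have : 0 < 1 + (‖d‖ * s) ^ 2 := by positivity
  rw [kernel₄, div_eq_mul_inv, norm_mul, norm_inv, norm_pow, ← inv_pow]
  calc ‖1 + (d * s) ^ 2‖ * ‖1 - (d * s) ^ 2‖⁻¹ ^ 2
      ≤ (1 + (‖d‖ * s) ^ 2) * (‖d‖ / d.im * (1 + (‖d‖ * s) ^ 2)⁻¹) ^ 2 := by
        gcongr
        exact norm_inv_one_sub_sq_le hd s
    _ = (‖d‖ / d.im) ^ 2 * (1 + (‖d‖ * s) ^ 2)⁻¹ := by field_simp

theorem norm_kernel₄_ray_mul_cexp_le {q : ℂ} (hq : 0 ≤ q.re) {s : ℝ} (hs : 0 ≤ s) :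
    ‖kernel₄ (d * s) * cexp (-(q * s))‖ ≤ (‖d‖ / d.im) ^ 2 * (1 + (‖d‖ * s) ^ 2)⁻¹ := by
  rw [norm_mul, norm_cexp_neg_mul]
  refine (mul_le_of_le_one_right (norm_nonneg _) ?_).trans (norm_kernel₄_ray_le hd s)
  exact Real.exp_le_one_iff.2 (neg_nonpos.2 (mul_nonneg hq hs))

theorem integrable_kernel₄_bound :
    Integrable fun s : ℝ => (‖d‖ / d.im) ^ 2 * (1 + (‖d‖ * s) ^ 2)⁻¹ :=
  (integrable_inv_one_add_sq.comp_mul_left' (R := ‖d‖)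
    (norm_ne_zero_iff.2 (by rintro rfl; simp at hd))).const_mul _

theorem continuous_kernel₃_ray : Continuous fun s : ℝ => kernel₃ (d * s) :=
  ContinuousOn.comp_continuous
    (fun _ hu => (hasDerivAt_kernel₃ hu).continuousAt.continuousWithinAt) (by fun_prop)
    (mul_ofReal_mem_kernelDomain hd.ne')

theorem continuous_kernel₄_ray : Continuous fun s : ℝ => kernel₄ (d * s) :=
  continuousOn_kernel₄.comp_continuous (by fun_prop) (mul_ofReal_mem_kernelDomain hd.ne')

/-- The Laplace integral of `kernel` is rotated onto the ray through `d` with exponent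
`exp (-q s)`, integrated by parts there for `0 < q.re`, and then `q` tends to `I`. -/
theorem integral_kernel_eq_integral_kernel₄ :
    ∫ s in Set.Ioi (0 : ℝ), kernel s * cexp (-(I / d * s)) =
      d ^ 5 * ∫ s in Set.Ioi (0 : ℝ), kernel₄ (d * s) * cexp (-(I * s)) := by
  have hd0 : d ≠ 0 := by rintro rfl; simp at hd
  have hre : 0 < (I / d).re := by
    have := normSq_pos.2 hd0
    rw [div_re]
    simpa using by positivity
  have hq : Tendsto (fun δ : ℝ => I + δ) (𝓝[>] 0) (𝓝 I) := by
    have : Continuous fun δ : ℝ => I + δ := by fun_prop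
    simpa using (this.tendsto 0).mono_left nhdsWithin_le_nhds
  have hleft : Tendsto (fun δ : ℝ => (I + δ) ^ 4 *
      ∫ s in Set.Ioi (0 : ℝ), kernel s * cexp (-((I + δ) / d * s))) (𝓝[>] 0)
      (𝓝 (∫ s in Set.Ioi (0 : ℝ), kernel s * cexp (-(I / d * s)))) := by
    have hcont := (isUpperRegular_kernel.differentiableOn_laplace.differentiableAt
      ((isOpen_lt continuous_const continuous_re).mem_nhds hre)).continuousAt
    simpa using (hq.pow 4).mul (hcont.tendsto.comp (hq.div_const d))
  have hright : Tendsto (fun δ : ℝ => d ^ 5 *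
      ∫ s in Set.Ioi (0 : ℝ), kernel₄ (d * s) * cexp (-((I + δ) * s))) (𝓝[>] 0)
      (𝓝 (d ^ 5 * ∫ s in Set.Ioi (0 : ℝ), kernel₄ (d * s) * cexp (-(I * s)))) := by
    refine (tendsto_integral_filter_of_dominated_convergence _ (.of_forall fun δ =>
      ((continuous_kernel₄_ray hd).mul (by fun_prop)).aestronglyMeasurable) ?_
      (integrable_kernel₄_bound hd).integrableOn (.of_forall fun s => ?_)).const_mul _
    · filter_upwards [self_mem_nhdsWithin] with δ hδ
      filter_upwards [ae_restrict_mem measurableSet_Ioi] with s hs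
      exact norm_kernel₄_ray_mul_cexp_le hd (by simpa using le_of_lt hδ) (le_of_lt hs)
    · exact ((hq.mul_const _).neg.cexp).const_mul _
  refine tendsto_nhds_unique_of_eventuallyEq hleft hright ?_
  filter_upwards [self_mem_nhdsWithin, ((continuous_re.tendsto _).comp (hq.div_const d)).eventually
    (lt_mem_nhds hre)] with δ hδ hδre
  have hmul : (I + δ) / d * d = I + δ := div_mul_cancel₀ _ hd0
  have hδ' : 0 < (I + δ : ℂ).re := by simpa using hδ
  have hray := isUpperRegular_kernel.integral_ray_eq (d := d) hδre ⟨hd.le, by rwa [hmul]⟩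
  rw [hmul] at hray
  rw [← hray, mul_left_comm, pow_mul_integral_kernel_eq hd hδ']
  ring

theorem integral_kernel₃_ray_eq (T : ℝ) :
    ∫ s in (0 : ℝ)..T, kernel₃ (d * s) * cexp (-(I * s)) =
      I * (kernel₃ (d * T) * cexp (-(I * T)))
        - I * d * ∫ s in (0 : ℝ)..T, kernel₄ (d * s) * cexp (-(I * s)) := by
  have hint₃ : IntervalIntegrable (fun s : ℝ => kernel₃ (d * s) * cexp (-(I * s))) volume 0 T :=
    ((continuous_kernel₃_ray hd).mul (by fun_prop)).intervalIntegrable 0 T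
  have hint₄ : IntervalIntegrable
      (fun s : ℝ => I * d * (kernel₄ (d * s) * cexp (-(I * s)))) volume 0 T :=
    (((continuous_kernel₄_ray hd).mul (by fun_prop)).intervalIntegrable 0 T).const_mul _
  have hderiv (s : ℝ) : HasDerivAt (fun s : ℝ => I * (kernel₃ (d * s) * cexp (-(I * s))))
      (I * d * (kernel₄ (d * s) * cexp (-(I * s))) + kernel₃ (d * s) * cexp (-(I * s))) s := by
    have hker := hasDerivAt_comp_mul_ofReal
      (hasDerivAt_kernel₃ (mul_ofReal_mem_kernelDomain hd.ne' s))
    refine ((hker.fun_mul (hasDerivAt_cexp_neg_mul I s)).const_mul I).congr_deriv ?_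
    linear_combination (-(kernel₃ (d * s) * cexp (-(I * s)))) * I_sq
  have h := intervalIntegral.integral_eq_sub_of_hasDerivAt (fun s _ => hderiv s)
    (hint₄.add hint₃)
  rw [intervalIntegral.integral_add hint₄ hint₃, intervalIntegral.integral_const_mul] at h
  simp only [ofReal_zero, mul_zero, kernel₃_zero, zero_mul, sub_zero] at h
  linear_combination h

theorem tendsto_integral_kernel₃_ray :
    Tendsto (fun T : ℝ => ∫ s in (0 : ℝ)..T, kernel₃ (d * s) * cexp (-(I * s))) atTop
      (𝓝 (-I / d ^ 4 * ∫ s in Set.Ioi (0 : ℝ), kernel s * cexp (-(I / d * s)))) := by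
  have hd0 : d ≠ 0 := by rintro rfl; simp at hd
  have hint : IntegrableOn (fun s : ℝ => kernel₄ (d * s) * cexp (-(I * s))) (Set.Ioi 0) := by
    refine (integrable_kernel₄_bound hd).integrableOn.mono'
      ((continuous_kernel₄_ray hd).mul (by fun_prop)).aestronglyMeasurable ?_
    filter_upwards [ae_restrict_mem measurableSet_Ioi] with s hs
    exact norm_kernel₄_ray_mul_cexp_le hd (by simp) (le_of_lt hs)
  have hboundary : Tendsto (fun T : ℝ => I * (kernel₃ (d * T) * cexp (-(I * T)))) atTop (𝓝 0) := by
    have hdecay : Tendsto (fun T : ℝ => ‖d‖ / d.im * (‖d‖ * T)⁻¹) atTop (𝓝 0) := by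
      simpa using (tendsto_inv_atTop_zero.comp
        (tendsto_id.const_mul_atTop (norm_pos_iff.2 hd0))).const_mul (‖d‖ / d.im)
    refine squeeze_zero_norm' ?_ hdecay
    filter_upwards [eventually_gt_atTop 0] with T hT
    have hpos : 0 < ‖d‖ * T := mul_pos (norm_pos_iff.2 hd0) hT
    have hnorm : ‖I * (kernel₃ (d * T) * cexp (-(I * T)))‖ = ‖kernel₃ (d * T)‖ := by
      simp [norm_cexp_neg_mul]
    rw [hnorm]
    refine (norm_kernel₃_ray_le hd T).trans ?_
    rw [abs_of_pos hT]
    gcongr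
    rw [← div_eq_mul_inv, ← one_div, div_le_div_iff₀ (by positivity) hpos]
    nlinarith
  have hlim := hboundary.sub ((intervalIntegral_tendsto_integral_Ioi 0 hint
    tendsto_id).const_mul (I * d))
  rw [integral_kernel_eq_integral_kernel₄ hd]
  convert! hlim using 2 with T
  · exact integral_kernel₃_ray_eq hd T
  · field_simp
    ring

theorem norm_integral_kernel₃_ray_le {T : ℝ} (hT : 0 ≤ T) :
    ‖∫ s in (0 : ℝ)..T, kernel₃ (d * s) * cexp (-(I * s))‖ ≤
      ‖d‖ / d.im + (‖d‖ / d.im) ^ 2 * (Real.pi / 2) := by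
  have hn : 0 < ‖d‖ := norm_pos_iff.2 (by rintro rfl; simp at hd)
  have hboundary : ‖kernel₃ (d * T)‖ ≤ ‖d‖ / d.im := by
    refine (norm_kernel₃_ray_le hd T).trans (mul_le_of_le_one_right (by positivity) ?_)
    rw [← div_eq_mul_inv, abs_of_nonneg hT]
    exact div_le_one_of_le₀ (by nlinarith [sq_nonneg (‖d‖ * T - 1)]) (by positivity)
  have hmain : ‖d‖ * ‖∫ s in (0 : ℝ)..T, kernel₄ (d * s) * cexp (-(I * s))‖ ≤
      (‖d‖ / d.im) ^ 2 * (Real.pi / 2) := by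
    have hint := integrable_kernel₄_bound hd
    calc _ ≤ ‖d‖ * ∫ s in (0 : ℝ)..T, (‖d‖ / d.im) ^ 2 * (1 + (‖d‖ * s) ^ 2)⁻¹ := by
          gcongr
          exact intervalIntegral.norm_integral_le_of_norm_le hT (.of_forall fun s hs =>
            norm_kernel₄_ray_mul_cexp_le hd (by simp) hs.1.le) hint.intervalIntegrable
      _ ≤ ‖d‖ * ∫ s in Set.Ioi (0 : ℝ), (‖d‖ / d.im) ^ 2 * (1 + (‖d‖ * s) ^ 2)⁻¹ := by
          rw [intervalIntegral.integral_of_le hT]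
          exact mul_le_mul_of_nonneg_left (setIntegral_mono_set hint.integrableOn
            (.of_forall fun s => by positivity) Set.Ioc_subset_Ioi_self.eventuallyLE) hn.le
      _ = _ := by
          rw [integral_const_mul, integral_comp_mul_left_Ioi (fun s : ℝ => (1 + s ^ 2)⁻¹) 0 hn,
            mul_zero, integral_Ioi_inv_one_add_sq, Real.arctan_zero, sub_zero, smul_eq_mul]
          field_simp
  rw [integral_kernel₃_ray_eq hd]
  refine (norm_sub_le _ _).trans (add_le_add ?_ ?_)
  · simpa [norm_cexp_neg_mul] using hboundary
  · simpa using hmain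

end Ray

/-! ### The coefficients -/

/-- The singularities `√π k / 2`, `k ≥ 1`, of the Borel transform on the positive half-line, with
indices shifted to start at `0`. -/
def pole (k : ℕ) : ℝ := (k + 1) * (√Real.pi / 2)

theorem pole_pos (k : ℕ) : 0 < pole k := by
  have := Real.pi_pos
  unfold pole
  positivity

theorem pole_zero_le (k : ℕ) : pole 0 ≤ pole k := by
  unfold pole
  gcongr
  simp

theorem inv_pole_pow_two_mul (n k : ℕ) :
    (pole k ^ (2 * n))⁻¹ = (4 / Real.pi) ^ n * (((k : ℝ) + 1) ^ (2 * n))⁻¹ := by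
  have hsq : pole k ^ 2 = ((k : ℝ) + 1) ^ 2 * (4 / Real.pi)⁻¹ := by
    rw [pole, mul_pow, div_pow, Real.sq_sqrt Real.pi_pos.le, inv_div]
    norm_num
  rw [pow_mul, hsq, mul_pow, mul_inv, inv_pow, inv_inv, ← pow_mul, mul_comm]

theorem summable_inv_succ_pow {m : ℕ} (hm : 2 ≤ m) :
    Summable fun k : ℕ => (((k : ℝ) + 1) ^ m)⁻¹ := by
  simpa using (summable_nat_add_iff 1).2 (Real.summable_nat_pow_inv (p := m).2 hm)

theorem summable_inv_pole_pow {m : ℕ} (hm : 2 ≤ m) : Summable fun k => (pole k ^ m)⁻¹ := by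
  simpa only [pole, mul_pow, mul_inv] using (summable_inv_succ_pow hm).mul_right _

/-- The power sums of the inverses of the singularities of the Borel transform. -/
def poleSum (m : ℕ) : ℝ := ∑' k, (pole k ^ m)⁻¹

theorem poleSum_pos {m : ℕ} (hm : 2 ≤ m) : 0 < poleSum m :=
  (summable_inv_pole_pow hm).tsum_pos (fun k => inv_nonneg.2 (pow_pos (pole_pos k) m).le) 0
    (inv_pos.2 (pow_pos (pole_pos 0) m))

theorem poleSum_two_mul (n : ℕ) :
    poleSum (2 * n) = (4 / Real.pi) ^ n * ∑' k : ℕ, (((k : ℝ) + 1) ^ (2 * n))⁻¹ := by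
  simp only [poleSum, inv_pole_pow_two_mul, tsum_mul_left]

theorem tsum_inv_succ_pow_two_mul {n : ℕ} (hn : n ≠ 0) :
    ∑' k : ℕ, (((k : ℝ) + 1) ^ (2 * n))⁻¹ = (-1 : ℝ) ^ (n + 1) * (2 : ℝ) ^ (2 * n - 1) *
      Real.pi ^ (2 * n) * bernoulli (2 * n) / (2 * n).factorial := by
  have h := (hasSum_nat_add_iff' 1).2 (hasSum_zeta_nat hn)
  simpa [hn] using h.tsum_eq

theorem kernelCoeff_two_mul {n : ℕ} (hn : 2 ≤ n) :
    kernelCoeff (2 * n) = ((2 * n - 3).factorial : ℝ) / (2 * n).factorial := by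
  obtain ⟨m, rfl⟩ := Nat.exists_eq_add_of_le' hn
  have : ((2 * m + 1).factorial : ℝ) ≠ 0 := mod_cast (2 * m + 1).factorial_ne_zero
  rw [kernelCoeff, if_pos (even_two_mul _), show 2 * (m + 2) - 3 = 2 * m + 1 by omega,
    show 2 * (m + 2) = 2 * m + 1 + 1 + 1 + 1 by ring, Nat.factorial_succ (2 * m + 1 + 1 + 1),
    Nat.factorial_succ (2 * m + 1 + 1), Nat.factorial_succ (2 * m + 1)]
  push_cast
  ring_nf
  field_simp
  ring

theorem a_eq {n : ℕ} (hn : 2 ≤ n) :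
    a n = 1 / (4 * Real.pi ^ 2) * (2 * n).factorial * kernelCoeff (2 * n) * poleSum (2 * n) := by
  rw [poleSum_two_mul, tsum_inv_succ_pow_two_mul (by omega), kernelCoeff_two_mul hn, a,
    if_neg (by omega)]
  have hpi : Real.pi ≠ 0 := Real.pi_ne_zero
  have hfac : ((2 * n).factorial : ℝ) ≠ 0 := mod_cast (2 * n).factorial_ne_zero
  have htwo : (2 : ℝ) ^ (2 * n - 1) = 4 ^ n / 2 := by
    rw [eq_div_iff two_ne_zero, ← pow_succ, show 2 * n - 1 + 1 = 2 * n by omega, pow_mul]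
    norm_num
  have hsixteen : (16 * Real.pi) ^ n = 4 ^ n * 4 ^ n * Real.pi ^ n := by
    rw [← mul_pow, ← mul_pow]
    norm_num
  rw [htwo, hsixteen, div_pow, pow_succ, pow_mul, pow_two Real.pi, mul_pow]
  field_simp
  ring

theorem a_pos {n : ℕ} (hn : 2 ≤ n) : 0 < a n := by
  have hsum : 0 < poleSum (2 * n) := poleSum_pos (by omega)
  have hcoeff : 0 < kernelCoeff (2 * n) := by
    rw [kernelCoeff_two_mul hn]
    positivity
  rw [a_eq hn]
  positivity

theorem sqrtSeries_coeff_div_factorial (j : ℕ) :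
    sqrtSeries coeff j / j.factorial =
      -(1 / (4 * (Real.pi : ℂ) ^ 2)) * (kernelCoeff j * poleSum j) := by
  have hfac : (j.factorial : ℂ) ≠ 0 := mod_cast j.factorial_ne_zero
  rcases Nat.even_or_odd j with heven | hodd
  · obtain ⟨n, rfl⟩ := heven.two_dvd
    rw [sqrtSeries, if_pos heven, Nat.mul_div_cancel_left n two_pos, coeff]
    rcases lt_or_ge n 2 with hn | hn
    · simp [a, hn, kernelCoeff_eq_zero (show 2 * n < 4 by omega)]
    · rw [a_eq hn]
      push_cast
      field_simp
  · simp [sqrtSeries, kernelCoeff, Nat.not_even_iff_odd.2 hodd]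

theorem tendsto_tsum_inv_succ_pow :
    Tendsto (fun m : ℕ => ∑' k : ℕ, (((k : ℝ) + 1) ^ m)⁻¹) atTop (𝓝 1) := by
  have h := tendsto_tsum_of_dominated_convergence (𝓕 := atTop)
    (f := fun m k : ℕ => (((k : ℝ) + 1) ^ m)⁻¹) (g := Pi.single 0 1)
    (summable_inv_succ_pow le_rfl) (fun k => ?_) ?_
  · simpa using h
  · rcases eq_or_ne k 0 with rfl | hk
    · simp
    · have hk' : 1 < (k : ℝ) + 1 := by simpa using Nat.pos_of_ne_zero hk
      simpa [hk] using! tendsto_inv_atTop_zero.comp (tendsto_pow_atTop_atTop_of_one_lt hk')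
  · filter_upwards [eventually_ge_atTop 2] with m hm k
    rw [norm_inv, norm_pow, Real.norm_of_nonneg (by positivity)]
    gcongr
    simp

theorem poleSum_two_mul_isEquivalent :
    (fun n => poleSum (2 * n)) ~[atTop] fun n => (4 / Real.pi) ^ n := by
  have h := (IsEquivalent.refl (u := fun n : ℕ => (4 / Real.pi) ^ n)).mul
    ((isEquivalent_const_iff_tendsto one_ne_zero).2 (tendsto_tsum_inv_succ_pow.comp
      (tendsto_id.const_mul_atTop' two_pos)))
  simpa only [Pi.mul_def, mul_one, Function.comp_def, Function.const_apply, id,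
    ← poleSum_two_mul] using h

theorem kernelCoeff_two_mul_isEquivalent :
    (fun n => kernelCoeff (2 * n)) ~[atTop] fun n => (8 * (n : ℝ) ^ 3)⁻¹ := by
  have hfactor (c : ℝ) : (fun n : ℕ => 2 * (n : ℝ) - c) ~[atTop] fun n => 2 * (n : ℝ) :=
    IsEquivalent.refl.sub_isLittleO <| isLittleO_const_left.2 <| .inr <|
      tendsto_norm_atTop_atTop.comp (tendsto_natCast_atTop_atTop.const_mul_atTop two_pos)
  have h := (((IsEquivalent.refl (u := fun n : ℕ => 2 * (n : ℝ))).mul (hfactor 1)).mul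
    (hfactor 2)).inv
  refine (h.congr_left ?_).congr_right ?_
  · filter_upwards with n
    simp [kernelCoeff]
  · filter_upwards with n
    simp only [Pi.inv_apply, Pi.mul_apply]
    ring

theorem a_isEquivalent : a ~[atTop] fun n : ℕ =>
    (4 / Real.pi) ^ n * ((2 * n).factorial : ℝ) / (32 * Real.pi ^ 2 * (n : ℝ) ^ 3) := by
  have h := ((IsEquivalent.refl (u := fun n : ℕ => 1 / (4 * Real.pi ^ 2) *
    ((2 * n).factorial : ℝ))).mul kernelCoeff_two_mul_isEquivalent).mul poleSum_two_mul_isEquivalent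
  refine (h.congr_left ?_).congr_right ?_
  · filter_upwards [eventually_ge_atTop 2] with n hn
    exact (a_eq hn).symm
  · filter_upwards with n
    simp only [Pi.mul_apply]
    field_simp
    ring

/-! ### The Borel transform -/

/-- The Borel transform of the perturbation series, on the closed upper half-plane and on its disk
of convergence. -/
def borel (t : ℂ) : ℂ := -(1 / (4 * (Real.pi : ℂ) ^ 2)) * ∑' k, kernel (t / pole k)

theorem isUpperRegular_borel : IsUpperRegular 4 borel :=
  (isUpperRegular_kernel.tsum_comp_div pole_pos (summable_inv_pole_pow (by norm_num))).const_mul _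

theorem summable_kernel_div_pole {t : ℂ} (ht : 0 ≤ t.im) : Summable fun k => kernel (t / pole k) :=
  isUpperRegular_kernel.summable_comp_div pole_pos (summable_inv_pole_pow (by norm_num)) ht

theorem hasSum_kernelCoeff_mul_div_pole_pow (j : ℕ) (t : ℂ) :
    HasSum (fun k => kernelCoeff j * (t / pole k) ^ j) (kernelCoeff j * poleSum j * t ^ j) := by
  rcases lt_or_ge j 4 with hj | hj
  · simp [kernelCoeff_eq_zero hj]
  · have hsum := (summable_inv_pole_pow (m := j) (by omega)).hasSum
    convert! ((Complex.hasSum_ofReal.2 hsum).mul_left (kernelCoeff j : ℂ)).mul_right (t ^ j)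
      using 2 with k
    push_cast
    rw [div_pow]
    ring

theorem norm_div_pole_lt_one {t : ℂ} (ht : ‖t‖ < pole 0) (k : ℕ) : ‖t / pole k‖ < 1 := by
  rw [norm_div, norm_real, Real.norm_of_nonneg (pole_pos k).le, div_lt_one (pole_pos k)]
  exact ht.trans_le (pole_zero_le k)

theorem summable_kernelCoeff_mul_div_pole_pow {t : ℂ} (ht : ‖t‖ < pole 0) :
    Summable fun x : ℕ × ℕ => (kernelCoeff x.2 : ℂ) * (t / pole x.1) ^ x.2 := by
  have hrow (k : ℕ) : HasSum (fun j => ‖(kernelCoeff j : ℂ) * (t / pole k) ^ j‖)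
      (kernel (‖t‖ / pole k)).re := by
    have hnorm : ‖((‖t‖ : ℂ) / pole k)‖ < 1 := by
      simpa using norm_div_pole_lt_one ht k
    convert! hasSum_re (hasSum_kernel hnorm) using 2 with j
    rw [norm_mul, norm_pow, norm_div, norm_real, norm_real,
      Real.norm_of_nonneg (kernelCoeff_nonneg j), Real.norm_of_nonneg (pole_pos k).le]
    norm_cast
  refine .of_norm ((summable_prod_of_nonneg fun x => norm_nonneg _).2
    ⟨fun k => (hrow k).summable, ?_⟩)
  simp only [(hrow _).tsum_eq]
  exact (hasSum_re (summable_kernel_div_pole (by simp)).hasSum).summable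

theorem hasSum_borel {t : ℂ} (ht : ‖t‖ < pole 0) :
    HasSum (fun j : ℕ => sqrtSeries coeff j / j.factorial * t ^ j) (borel t) := by
  set F : ℕ × ℕ → ℂ := fun x => kernelCoeff x.2 * (t / pole x.1) ^ x.2
  have hsum : HasSum F (∑' x, F x) := (summable_kernelCoeff_mul_div_pole_pow ht).hasSum
  have hrow (k : ℕ) : HasSum (fun j => kernelCoeff j * (t / pole k) ^ j) (kernel (t / pole k)) :=
    hasSum_kernel (norm_div_pole_lt_one ht k)
  have hrows : HasSum (fun k => kernel (t / pole k)) (∑' x, F x) :=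
    hsum.prod_fiberwise hrow
  have hcols : HasSum (fun j => (kernelCoeff j : ℂ) * poleSum j * t ^ j) (∑' x, F x) :=
    ((Equiv.prodComm ℕ ℕ).hasSum_iff.2 hsum).prod_fiberwise fun j =>
      hasSum_kernelCoeff_mul_div_pole_pow j t
  rw [borel, hrows.tsum_eq]
  simpa only [sqrtSeries_coeff_div_factorial, mul_assoc] using
    hcols.mul_left (-(1 / (4 * (Real.pi : ℂ) ^ 2)))

theorem exists_norm_borel_sub_sum_le {M : ℕ} (hM : 4 ≤ M) : ∃ C : ℝ, ∀ t : ℝ, 0 < t →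
    ‖borel t - ∑ j ∈ Finset.range M, sqrtSeries coeff j / j.factorial * (t : ℂ) ^ j‖ ≤
      C * t ^ M := by
  have hreg := ((isUpperRegular_kernel_sub_sum hM).tsum_comp_div pole_pos
    (summable_inv_pole_pow (by omega))).const_mul (-(1 / (4 * (Real.pi : ℂ) ^ 2)))
  obtain ⟨C, -, hC⟩ := hreg.exists_norm_ofReal_le
  refine ⟨C, fun t ht => ?_⟩
  convert! hC t ht using 2
  have hpoly := hasSum_sum fun j (_ : j ∈ Finset.range M) =>
    hasSum_kernelCoeff_mul_div_pole_pow j (t : ℂ)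
  rw [(summable_kernel_div_pole (by simp)).tsum_sub hpoly.summable, hpoly.tsum_eq, mul_sub,
    Finset.mul_sum, borel]
  simp only [sqrtSeries_coeff_div_factorial, mul_assoc]

/-! ### The Laplace integral of the Borel transform -/

/-- The Laplace-Borel integral of the boundary value of the Borel transform. -/
def laplaceBorel (β : ℂ) : ℂ :=
  β⁻¹ * ∫ t in Set.Ioi (0 : ℝ), borel t * cexp (-(β⁻¹ * t))

theorem ne_zero_of_re_pos {β : ℂ} (hβ : 0 < β.re) : β ≠ 0 := ne_of_apply_ne re hβ.ne'

theorem inv_re_pos {β : ℂ} (hβ : 0 < β.re) : 0 < (β⁻¹).re := by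
  rw [inv_re]
  exact div_pos hβ (normSq_pos.2 (ne_zero_of_re_pos hβ))

theorem differentiableOn_laplaceBorel : DifferentiableOn ℂ laplaceBorel {β | 0 < β.re} := by
  have hinv : DifferentiableOn ℂ (fun β : ℂ => β⁻¹) {β | 0 < β.re} :=
    differentiableOn_inv.mono fun β => ne_zero_of_re_pos
  exact hinv.mul (isUpperRegular_borel.differentiableOn_laplace.comp hinv fun β => inv_re_pos)

theorem laplace_comp_div (f : ℂ → ℂ) {r : ℝ} (hr : 0 < r) (p : ℂ) :
    ∫ t in Set.Ioi (0 : ℝ), f (t / r) * cexp (-(p * t)) =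
      r * ∫ s in Set.Ioi (0 : ℝ), f s * cexp (-(r * p * s)) := by
  have h := integral_comp_mul_left_Ioi (fun t : ℝ => f (t / r) * cexp (-(p * t))) 0 hr
  rw [mul_zero, eq_inv_smul_iff₀ hr.ne', real_smul] at h
  rw [← h]
  congr! 4 with s
  · rw [ofReal_mul, mul_div_cancel_left₀ _ (ofReal_ne_zero.2 hr.ne')]
  · push_cast
    ring_nf

/-- The direction of the ray traversed by `u = i β s / r`, for `r` the `k`-th singularity of the
Borel transform: in this variable the `k`-th summand of the integrand of `S(β²)` is a multiple of
`kernel₃`. -/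
def rayDir (β : ℂ) (k : ℕ) : ℂ := I * β / pole k

theorem rayDir_im (β : ℂ) (k : ℕ) : (rayDir β k).im = β.re / pole k := by
  rw [rayDir, div_ofReal_im, I_mul_im]

theorem rayDir_im_pos {β : ℂ} (hβ : 0 < β.re) (k : ℕ) : 0 < (rayDir β k).im := by
  rw [rayDir_im]
  exact div_pos hβ (pole_pos k)

theorem norm_rayDir (β : ℂ) (k : ℕ) : ‖rayDir β k‖ = ‖β‖ / pole k := by
  rw [rayDir, norm_div, norm_mul, norm_I, one_mul, norm_real, Real.norm_of_nonneg (pole_pos k).le]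

theorem norm_rayDir_div_im (β : ℂ) (k : ℕ) : ‖rayDir β k‖ / (rayDir β k).im = ‖β‖ / β.re := by
  rw [norm_rayDir, rayDir_im, div_div_div_cancel_right₀ (pole_pos k).ne']

theorem I_div_rayDir (β : ℂ) (k : ℕ) : I / rayDir β k = pole k * β⁻¹ := by
  rw [rayDir, div_div_eq_mul_div, mul_div_mul_left _ _ I_ne_zero, div_eq_mul_inv]

theorem hasSum_laplaceBorel {β : ℂ} (hβ : 0 < β.re) :
    HasSum (fun k => -(1 / (4 * (Real.pi : ℂ) ^ 2)) * (I / rayDir β k *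
      ∫ s in Set.Ioi (0 : ℝ), kernel s * cexp (-(I / rayDir β k * s)))) (laplaceBorel β) := by
  have h := (isUpperRegular_kernel.hasSum_laplace_comp_div pole_pos
    (summable_inv_pole_pow (by norm_num)) (inv_re_pos hβ)).mul_left
      (-(1 / (4 * (Real.pi : ℂ) ^ 2)) * β⁻¹)
  convert! h using 1
  · ext k
    rw [laplace_comp_div _ (pole_pos k), I_div_rayDir]
    ring
  · simp only [laplaceBorel, borel, mul_assoc, integral_const_mul]
    ring

/-! ### The effective action as a Laplace integral -/

theorem hasSum_cot_sub {z : ℂ} (hz : z ∈ integerComplement) :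
    HasSum (fun k : ℕ => -2 * (z / (k + 1)) ^ 3 * kernel₃ (z / (k + 1)))
      (Real.pi * z * cot (Real.pi * z) - 1 + (Real.pi * z) ^ 2 / 3) := by
  have hcot := (summable_cotTerm hz).hasSum
  rw [← cot_series_rep' hz] at hcot
  have hzeta : HasSum (fun k : ℕ => (((k : ℂ) + 1) ^ 2)⁻¹) ((Real.pi : ℂ) ^ 2 / 6) := by
    have h : HasSum (fun k : ℕ => (((k : ℝ) + 1) ^ 2)⁻¹) (Real.pi ^ 2 / 6) := by
      simpa using (hasSum_nat_add_iff' 1).2 hasSum_zeta_two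
    simpa using Complex.hasSum_ofReal.2 h
  convert! (hcot.mul_left z).add (hzeta.mul_left (2 * z ^ 2)) using 1
  · ext k
    have hk : (k : ℂ) + 1 ≠ 0 := mod_cast k.succ_ne_zero
    have hadd : z + (k + 1) ≠ 0 := by
      simpa using integerComplement_add_ne_zero hz (k + 1)
    have hsub : z - (k + 1) ≠ 0 := by
      simpa [sub_eq_add_neg] using integerComplement_add_ne_zero hz (-(k + 1))
    have hden : 1 - (z / (k + 1)) ^ 2 = -((z - (k + 1)) * (z + (k + 1))) / (k + 1) ^ 2 := by
      field_simp
      ring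
    rw [kernel₃, hden, cotTerm]
    field_simp
    ring
  · have hz0 := integerComplement.ne_zero hz
    field_simp
    ring

theorem hasSum_xcoth {x : ℂ} (hx : 0 < x.re) :
    HasSum (fun k : ℕ => -2 * (I * x / Real.pi / (k + 1)) ^ 3 * kernel₃ (I * x / Real.pi / (k + 1)))
      (xcoth x - 1 - x ^ 2 / 3) := by
  have him : 0 < (I * x / Real.pi).im := by
    simpa [div_ofReal_im] using div_pos hx Real.pi_pos
  convert! hasSum_cot_sub (UpperHalfPlane.coe_mem_integerComplement ⟨_, him⟩) using 1
  have hpi : (Real.pi : ℂ) ≠ 0 := ofReal_ne_zero.2 Real.pi_ne_zero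
  rw [UpperHalfPlane.coe_mk, mul_div_cancel₀ _ hpi, mul_comm I, mul_pow, I_sq, cot, cos_mul_I,
    sin_mul_I, xcoth, if_neg (ne_zero_of_re_pos hx), mul_assoc x I,
    mul_div_assoc' I, mul_comm (sinh x), mul_div_mul_left _ _ I_ne_zero]
  ring

theorem hasSum_integrand {β : ℂ} (hβ : 0 < β.re) {s : ℝ} (hs : 0 ≤ s) :
    HasSum (fun k => -2 * rayDir β k ^ 3 * (kernel₃ (rayDir β k * s) * cexp (-(I * s))))
      (integrand (β ^ 2) s) := by
  rcases hs.eq_or_lt with rfl | hs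
  · simp [integrand, kernel₃_zero]
  have hsqrt : 0 < √Real.pi := Real.sqrt_pos.2 Real.pi_pos
  have hsqrt0 : ((√Real.pi : ℝ) : ℂ) ≠ 0 := ofReal_ne_zero.2 hsqrt.ne'
  have hpi : (Real.pi : ℂ) = (√Real.pi : ℝ) ^ 2 := mod_cast (Real.sq_sqrt Real.pi_pos.le).symm
  have hroot : ((Real.pi : ℂ) * β ^ 2) ^ (1 / 2 : ℂ) = (√Real.pi : ℝ) * β := by
    rw [hpi, ← mul_pow, one_div]
    exact sq_cpow_two_inv (by simpa using mul_pos hsqrt hβ)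
  have hx : 0 < (2 * ((√Real.pi : ℝ) * β) * s).re := by
    simpa using mul_pos (mul_pos two_pos (mul_pos hsqrt hβ)) hs
  convert! (hasSum_xcoth hx).mul_left (cexp (-I * s) / (s : ℂ) ^ 3) using 1
  · ext k
    have hs0 : (s : ℂ) ≠ 0 := ofReal_ne_zero.2 hs.ne'
    have hray : I * (2 * ((√Real.pi : ℝ) * β) * s) / Real.pi / (k + 1) = rayDir β k * s := by
      have hk : (k : ℂ) + 1 ≠ 0 := mod_cast k.succ_ne_zero
      rw [rayDir, pole, hpi]
      push_cast
      field_simp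
    rw [hray, neg_mul I]
    field_simp
  · rw [integrand, hroot, mul_pow, mul_pow, mul_pow, ← hpi]
    ring

theorem norm_integrand_summand_le {β : ℂ} (hβ : 0 < β.re) (k : ℕ) (s : ℝ) :
    ‖-2 * rayDir β k ^ 3 * (kernel₃ (rayDir β k * s) * cexp (-(I * s)))‖ ≤
      2 * ‖β‖ ^ 3 * (‖β‖ / β.re) * (pole k ^ 3)⁻¹ := by
  have hkernel : ‖kernel₃ (rayDir β k * s)‖ ≤ ‖β‖ / β.re := by
    have hle (x : ℝ) : |x| * (1 + x ^ 2)⁻¹ ≤ 1 :=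
      mul_inv_le_one_of_le₀ (by nlinarith [sq_abs x, sq_nonneg (|x| - 1)]) (by positivity)
    refine (norm_kernel₃_ray_le (rayDir_im_pos hβ k) s).trans ?_
    rw [norm_rayDir_div_im]
    have h := hle (‖rayDir β k‖ * s)
    rw [abs_mul, abs_norm] at h
    exact mul_le_of_le_one_right (by positivity) h
  have hexp : ‖cexp (-(I * s))‖ = 1 := by simp [norm_cexp_neg_mul]
  rw [norm_mul, norm_mul, norm_mul, hexp, mul_one, norm_neg, norm_pow, norm_rayDir, div_pow,
    Complex.norm_ofNat]
  calc 2 * (‖β‖ ^ 3 / pole k ^ 3) * ‖kernel₃ (rayDir β k * s)‖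
    _ ≤ 2 * (‖β‖ ^ 3 / pole k ^ 3) * (‖β‖ / β.re) := by
      have := pole_pos k
      gcongr
    _ = _ := by ring

theorem summable_integrand_bound (β : ℂ) :
    Summable fun k => 2 * ‖β‖ ^ 3 * (‖β‖ / β.re) * (pole k ^ 3)⁻¹ :=
  (summable_inv_pole_pow (by norm_num)).mul_left _

theorem continuous_integrand_summand {β : ℂ} (hβ : 0 < β.re) (k : ℕ) : Continuous fun s : ℝ =>
    -2 * rayDir β k ^ 3 * (kernel₃ (rayDir β k * s) * cexp (-(I * s))) :=
  continuous_const.mul ((continuous_kernel₃_ray (rayDir_im_pos hβ k)).mul (by fun_prop))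

theorem intervalIntegrable_integrand {β : ℂ} (hβ : 0 < β.re) {T : ℝ} (hT : 0 ≤ T) :
    IntervalIntegrable (integrand (β ^ 2)) volume 0 T := by
  have hcont := continuous_tsum (continuous_integrand_summand hβ) (summable_integrand_bound β)
    (norm_integrand_summand_le hβ)
  refine (hcont.intervalIntegrable 0 T).congr fun s hs => ?_
  rw [Set.uIoc_of_le hT] at hs
  exact (hasSum_integrand hβ hs.1.le).tsum_eq

theorem hasSum_actionUpTo {β : ℂ} (hβ : 0 < β.re) {T : ℝ} (hT : 0 ≤ T) :
    HasSum (fun k => 1 / (4 * (Real.pi : ℂ) ^ 2) * rayDir β k ^ 3 *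
      ∫ s in (0 : ℝ)..T, kernel₃ (rayDir β k * s) * cexp (-(I * s))) (actionUpTo (β ^ 2) T) := by
  have h := intervalIntegral.hasSum_integral_of_dominated_convergence (μ := volume)
    (a := 0) (b := T) (f := integrand (β ^ 2)) (fun k _ => _)
    (fun k => (continuous_integrand_summand hβ k).aestronglyMeasurable)
    (fun k => .of_forall fun s _ => norm_integrand_summand_le hβ k s)
    (.of_forall fun s _ => summable_integrand_bound β) intervalIntegrable_const
    (.of_forall fun s hs => hasSum_integrand hβ (Set.uIoc_of_le hT ▸ hs).1.le)
  convert! h.mul_left (-(1 / (8 * (Real.pi : ℂ) ^ 2))) using 2 with k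
  rw [intervalIntegral.integral_const_mul]
  ring

theorem norm_actionUpTo_summand_le {β : ℂ} (hβ : 0 < β.re) {T : ℝ} (hT : 0 ≤ T) (k : ℕ) :
    ‖1 / (4 * (Real.pi : ℂ) ^ 2) * rayDir β k ^ 3 *
        ∫ s in (0 : ℝ)..T, kernel₃ (rayDir β k * s) * cexp (-(I * s))‖ ≤
      ‖1 / (4 * (Real.pi : ℂ) ^ 2)‖ * ‖β‖ ^ 3 *
        (‖β‖ / β.re + (‖β‖ / β.re) ^ 2 * (Real.pi / 2)) * (pole k ^ 3)⁻¹ := by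
  have h := norm_integral_kernel₃_ray_le (rayDir_im_pos hβ k) hT
  rw [norm_rayDir_div_im] at h
  have hk := pole_pos k
  rw [norm_mul, norm_mul, norm_pow, norm_rayDir, div_pow]
  calc _ ≤ ‖1 / (4 * (Real.pi : ℂ) ^ 2)‖ * (‖β‖ ^ 3 / pole k ^ 3) *
        (‖β‖ / β.re + (‖β‖ / β.re) ^ 2 * (Real.pi / 2)) := by gcongr
    _ = _ := by ring

theorem tendsto_actionUpTo_sq {β : ℂ} (hβ : 0 < β.re) :
    Tendsto (actionUpTo (β ^ 2)) atTop (𝓝 (laplaceBorel β)) := by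
  rw [← (hasSum_laplaceBorel hβ).tsum_eq]
  have hsum : (fun T => ∑' k, 1 / (4 * (Real.pi : ℂ) ^ 2) * rayDir β k ^ 3 *
      ∫ s in (0 : ℝ)..T, kernel₃ (rayDir β k * s) * cexp (-(I * s))) =ᶠ[atTop]
      actionUpTo (β ^ 2) :=
    (eventually_ge_atTop 0).mono fun T hT => (hasSum_actionUpTo hβ hT).tsum_eq
  refine Tendsto.congr' hsum (tendsto_tsum_of_dominated_convergence
    ((summable_inv_pole_pow (m := 3) (by norm_num)).mul_left _) (fun k => ?_)
    ((eventually_ge_atTop 0).mono fun T hT => norm_actionUpTo_summand_le hβ hT))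
  have hray : rayDir β k ≠ 0 := ne_of_apply_ne im (rayDir_im_pos hβ k).ne'
  convert! (tendsto_integral_kernel₃_ray (rayDir_im_pos hβ k)).const_mul
    (1 / (4 * (Real.pi : ℂ) ^ 2) * rayDir β k ^ 3) using 2
  field_simp

theorem S_sq {β : ℂ} (hβ : 0 < β.re) : S (β ^ 2) = laplaceBorel β :=
  (tendsto_actionUpTo_sq hβ).limUnder_eq

theorem sqrt_re_pos {α : ℂ} (hα : α ∈ slitPlane) : 0 < (α ^ (2⁻¹ : ℂ)).re := by
  have harg : (log α * 2⁻¹).im = α.arg / 2 := by simp [div_eq_mul_inv, log_im]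
  rw [cpow_def_of_ne_zero (slitPlane_ne_zero hα), exp_re, harg]
  have hlt := (arg_le_pi α).lt_of_ne (slitPlane_arg_ne_pi hα)
  exact mul_pos (Real.exp_pos _) (Real.cos_pos_of_mem_Ioo
    ⟨by linarith [neg_pi_lt_arg α], by linarith⟩)

theorem sqrt_sq (α : ℂ) : (α ^ (2⁻¹ : ℂ)) ^ 2 = α := by simp

theorem S_eq_laplaceBorel {α : ℂ} (hα : α ∈ slitPlane) : S α = laplaceBorel (α ^ (2⁻¹ : ℂ)) := by
  rw [← S_sq (sqrt_re_pos hα), sqrt_sq]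

theorem converges {α : ℂ} (hα : α ∈ slitPlane) :
    (∀ T : ℝ, 0 ≤ T → IntervalIntegrable (integrand α) volume 0 T) ∧
      Tendsto (actionUpTo α) atTop (𝓝 (S α)) := by
  have hβ := sqrt_re_pos hα
  rw [S_eq_laplaceBorel hα, ← sqrt_sq α]
  exact ⟨fun T hT => intervalIntegrable_integrand hβ hT, by simpa using tendsto_actionUpTo_sq hβ⟩

theorem analyticOnNhd_S : AnalyticOnNhd ℂ S slitPlane := by
  have hsqrt : DifferentiableOn ℂ (fun α : ℂ => α ^ (2⁻¹ : ℂ)) slitPlane := fun α hα =>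
    (differentiableAt_id.cpow_const hα).differentiableWithinAt
  exact ((differentiableOn_laplaceBorel.comp hsqrt fun α hα => sqrt_re_pos hα).congr
    fun α hα => S_eq_laplaceBorel hα).analyticOnNhd isOpen_slitPlane

theorem S_zero : S 0 = 0 := by
  have h : actionUpTo 0 = fun _ => 0 := by
    ext T
    simp [actionUpTo, integrand, xcoth]
  rw [S, h]
  exact tendsto_const_nhds.limUnder_eq

theorem half_add_conj_S {α : ℝ} : (S α + conj (S (conj (α : ℂ)))) / 2 = ((S α).re : ℂ) := by
  rw [conj_ofReal, re_eq_add_conj]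

/-! ### The perturbation expansion -/

theorem sum_coeff_mul_sq_pow (β : ℂ) (N : ℕ) :
    ∑ n ∈ Finset.range N, coeff n * (β ^ 2) ^ n =
      ∑ j ∈ Finset.range (2 * N), sqrtSeries coeff j * β ^ j := by
  induction N with
  | zero => simp
  | succ N ih =>
    rw [Finset.sum_range_succ, ih, show 2 * (N + 1) = 2 * N + 1 + 1 by ring,
      Finset.sum_range_succ, Finset.sum_range_succ, add_assoc]
    simp [sqrtSeries, pow_mul]

theorem exists_norm_laplaceBorel_sub_sum_le {N : ℕ} (hN : 2 ≤ N) : ∃ C : ℝ, ∀ β : ℂ, 0 < β.re →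
    ‖laplaceBorel β - ∑ n ∈ Finset.range N, coeff n * (β ^ 2) ^ n‖ ≤
      ‖β‖⁻¹ * (C * ((2 * N).factorial / β⁻¹.re ^ (2 * N + 1))) := by
  obtain ⟨C, hC⟩ := exists_norm_borel_sub_sum_le (M := 2 * N) (by lia)
  refine ⟨C, fun β hβ => ?_⟩
  rw [sum_coeff_mul_sq_pow]
  exact norm_inv_mul_integral_mul_cexp_sub_sum_le
    isUpperRegular_borel.continuous_ofReal.aestronglyMeasurable hC (inv_re_pos hβ)

theorem inv_two_mul_norm_le_inv_re {β : ℂ} (hβ : 0 < β.re) (hβ2 : 0 < (β ^ 2).re) :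
    (2 * ‖β‖)⁻¹ ≤ β⁻¹.re := by
  have hβ0 : 0 < ‖β‖ := norm_pos_iff.2 (ne_zero_of_re_pos hβ)
  have hnorm : ‖β‖ ^ 2 = β.re ^ 2 + β.im ^ 2 := by
    rw [← normSq_eq_norm_sq, normSq_apply]
    ring
  have him : β.im ^ 2 < β.re ^ 2 := by
    rw [sq, mul_re] at hβ2
    linarith
  have hre : ‖β‖ / 2 ≤ β.re := le_of_sq_le_sq (by nlinarith) hβ.le
  rw [inv_re, normSq_eq_norm_sq, le_div_iff₀ (by positivity)]
  calc (2 * ‖β‖)⁻¹ * ‖β‖ ^ 2 = ‖β‖ / 2 := by field_simp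
    _ ≤ β.re := hre

theorem expansion_of_two_le {N : ℕ} (hN : 2 ≤ N) :
    (fun α : ℂ => S α - ∑ n ∈ Finset.range N, coeff n * α ^ n)
      =O[𝓝[{α : ℂ | 0 < α.re}] 0] fun α : ℂ => α ^ N := by
  obtain ⟨C, hC⟩ := exists_norm_laplaceBorel_sub_sum_le hN
  refine .of_bound (|C| * (2 * N).factorial * 2 ^ (2 * N + 1)) ?_
  filter_upwards [self_mem_nhdsWithin] with α (hα : 0 < α.re)
  obtain ⟨β, hβ, rfl⟩ : ∃ β : ℂ, 0 < β.re ∧ β ^ 2 = α :=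
    ⟨_, sqrt_re_pos (.inl hα), sqrt_sq α⟩
  have hβ0 : ‖β‖ ≠ 0 := norm_ne_zero_iff.2 (ne_zero_of_re_pos hβ)
  have hinv := inv_two_mul_norm_le_inv_re hβ hα
  rw [S_sq hβ]
  calc ‖laplaceBorel β - ∑ n ∈ Finset.range N, coeff n * (β ^ 2) ^ n‖
      ≤ ‖β‖⁻¹ * (C * ((2 * N).factorial / β⁻¹.re ^ (2 * N + 1))) := hC β hβ
    _ ≤ ‖β‖⁻¹ * (|C| * ((2 * N).factorial / (2 * ‖β‖)⁻¹ ^ (2 * N + 1))) := by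
      have := inv_re_pos hβ
      gcongr
      exact le_abs_self C
    _ = |C| * (2 * N).factorial * 2 ^ (2 * N + 1) * ‖(β ^ 2) ^ N‖ := by
      rw [inv_pow, div_inv_eq_mul, mul_pow, pow_succ ‖β‖, norm_pow, norm_pow, ← pow_mul]
      field_simp

theorem expansion (N : ℕ) :
    (fun α : ℂ => S α - ∑ n ∈ Finset.range N, coeff n * α ^ n)
      =O[𝓝[{α : ℂ | 0 < α.re}] 0] fun α : ℂ => α ^ N := by
  rcases le_or_gt 2 N with hN | hN
  · exact expansion_of_two_le hN
  have hzero {M : ℕ} (hM : M ≤ 2) (α : ℂ) : ∑ n ∈ Finset.range M, coeff n * α ^ n = 0 := by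
    refine Finset.sum_eq_zero fun n hn => ?_
    rw [coeff, a, if_pos (by have := Finset.mem_range.1 hn; lia), ofReal_zero, neg_zero, zero_mul]
  have h := expansion_of_two_le (N := 2) le_rfl
  simp only [hzero le_rfl, hzero hN.le] at h ⊢
  exact h.trans ((isLittleO_pow_pow hN).isBigO.mono nhdsWithin_le_nhds)

/-! ### Boundary values as distributions -/

/-- The distribution `φ ↦ ∫₀^∞ f(t) φ(t) dt` carried by `[0, ∞)`. For `f` regular up to the
boundary of the upper half-plane this is the boundary value `f (t + i0)`, `t ≥ 0`. -/
def boundaryDist (f : ℂ → ℂ) : 𝓓'((⊤ : TopologicalSpace.Opens ℝ), ℂ) :=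
  (TestFunction.integralAgainstBilinCLM (ContinuousLinearMap.lsmul ℝ ℝ)
    (volume.restrict (Set.Ioi 0)) (fun t : ℝ => f t) :
      𝓓((⊤ : TopologicalSpace.Opens ℝ), ℝ) →L[ℝ] ℂ)

theorem laplaceTest_apply (χ : 𝓓((⊤ : TopologicalSpace.Opens ℝ), ℝ)) (z : ℂ) (m : ℕ) (t : ℝ) :
    laplaceTest χ z m t = χ (t / ((m : ℝ) + 1)) * cexp (-(z⁻¹ * t)) := by
  rw [← div_eq_inv_mul, ← neg_div]
  rfl

theorem tendsto_testFunction_dilate {χ : 𝓓((⊤ : TopologicalSpace.Opens ℝ), ℝ)}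
    (hχ : ∀ᶠ t in 𝓝 (0 : ℝ), χ t = 1) (t : ℝ) :
    Tendsto (fun m : ℕ => (χ (t / ((m : ℝ) + 1)) : ℂ)) atTop (𝓝 1) := by
  have hdiv : Tendsto (fun m : ℕ => t / ((m : ℝ) + 1)) atTop (𝓝 0) := by
    simpa [div_eq_mul_inv] using
      (tendsto_one_div_add_atTop_nhds_zero_nat (𝕜 := ℝ)).const_mul t
  exact tendsto_const_nhds.congr' <| (hdiv.eventually hχ).mono fun m hm => by simp [hm]

namespace IsUpperRegular

variable {n : ℕ} {f : ℂ → ℂ}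

theorem locallyIntegrableOn (hf : IsUpperRegular n f) :
    LocallyIntegrableOn (fun t : ℝ => f t) ((⊤ : TopologicalSpace.Opens ℝ) : Set ℝ)
      (volume.restrict (Set.Ioi 0)) :=
  hf.continuous_ofReal.locallyIntegrable.locallyIntegrableOn _

theorem boundaryDist_apply (hf : IsUpperRegular n f)
    (φ : 𝓓((⊤ : TopologicalSpace.Opens ℝ), ℝ)) :
    boundaryDist f φ = ∫ t in Set.Ioi (0 : ℝ), f t * φ t := by
  refine (TestFunction.integralAgainstBilinCLM_eq_integral
    (B := ContinuousLinearMap.lsmul ℝ ℝ) hf.locallyIntegrableOn (f := φ)).trans ?_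
  simp [mul_comm]

theorem integrableOn_mul_testFunction (hf : IsUpperRegular n f)
    (φ : 𝓓((⊤ : TopologicalSpace.Opens ℝ), ℝ)) :
    IntegrableOn (fun t : ℝ => f t * φ t) (Set.Ioi 0) := by
  simpa [mul_comm, IntegrableOn] using
    TestFunction.integrable_bilin (ContinuousLinearMap.lsmul ℝ ℝ) hf.locallyIntegrableOn φ

theorem pair_boundaryDist (hf : IsUpperRegular n f)
    (ψ : 𝓓((⊤ : TopologicalSpace.Opens ℝ), ℂ)) :
    pair (boundaryDist f) ψ = ∫ t in Set.Ioi (0 : ℝ), f t * ψ t := by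
  rw [pair, hf.boundaryDist_apply, hf.boundaryDist_apply, ← integral_const_mul,
    ← integral_add (hf.integrableOn_mul_testFunction _)
      ((hf.integrableOn_mul_testFunction _).const_mul I)]
  congr! 2 with t
  simp only [TestFunction.postcompCLM_apply, Function.comp, reCLM_apply, imCLM_apply]
  conv_rhs => rw [← re_add_im (ψ t)]
  ring

theorem tendsto_add_mul_I (hf : IsUpperRegular n f) (t : ℝ) :
    Tendsto (fun ε : ℝ => f (t + ε * I)) (𝓝[>] 0) (𝓝 (f t)) := by
  refine (hf.continuousOn (t : ℂ) (by simp)).tendsto.comp (tendsto_nhdsWithin_iff.2 ⟨?_, ?_⟩)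
  · have hcont : Continuous fun ε : ℝ => (t : ℂ) + ε * I := by fun_prop
    simpa using (hcont.tendsto 0).mono_left nhdsWithin_le_nhds
  · filter_upwards [self_mem_nhdsWithin] with ε (hε : 0 < ε)
    simpa using hε.le

theorem tendsto_integral_boundaryDist (hf : IsUpperRegular n f)
    (φ : 𝓓((⊤ : TopologicalSpace.Opens ℝ), ℝ)) :
    Tendsto (fun ε : ℝ => ∫ t in Set.Ioi (0 : ℝ), f (t + ε * I) * (φ t : ℂ))
      (𝓝[>] 0) (𝓝 (boundaryDist f φ)) := by
  obtain ⟨C, hC0, hC⟩ := hf.exists_nonneg_norm_le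
  have hφ : Continuous φ := φ.continuous
  have hbound : Integrable fun t : ℝ => C * (|t| + 1) ^ n * |φ t| :=
    (by fun_prop : Continuous fun t : ℝ =>
      C * (|t| + 1) ^ n * |φ t|).integrable_of_hasCompactSupport
      (φ.hasCompactSupport.comp_left (g := fun x : ℝ => |x|) abs_zero).mul_left
  rw [hf.boundaryDist_apply]
  refine tendsto_integral_filter_of_dominated_convergence _ ?_ ?_ hbound.integrableOn
    (.of_forall fun t => (hf.tendsto_add_mul_I t).mul_const _)
  · filter_upwards [self_mem_nhdsWithin] with ε (hε : 0 < ε)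
    have hcont : Continuous fun t : ℝ => f (t + ε * I) :=
      hf.continuousOn.comp_continuous (by fun_prop) fun t => by simpa using hε.le
    exact (hcont.mul (Complex.continuous_ofReal.comp hφ)).aestronglyMeasurable
  · filter_upwards [Ioc_mem_nhdsGT one_pos] with ε hε
    refine .of_forall fun t => ?_
    have hnorm : ‖(t : ℂ) + ε * I‖ ≤ |t| + 1 := by
      refine (norm_add_le _ _).trans ?_
      simpa [abs_of_pos hε.1] using hε.2
    rw [norm_mul, norm_real, Real.norm_eq_abs]
    gcongr
    exact (hC _ (by simpa using hε.1.le)).trans (by gcongr)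

theorem hasLaplaceBorelIntegral (hf : IsUpperRegular n f) {z : ℂ} (hz : 0 < z⁻¹.re) :
    HasLaplaceBorelIntegral (boundaryDist f) z
      (z⁻¹ * ∫ t in Set.Ioi (0 : ℝ), f t * cexp (-(z⁻¹ * t))) := by
  obtain ⟨C, -, hC⟩ := hf.exists_norm_ofReal_le
  intro χ hχ
  obtain ⟨M, hM⟩ := χ.continuous.bounded_above_of_compact_support χ.hasCompactSupport
  simp only [hf.pair_boundaryDist, laplaceTest_apply]
  refine (tendsto_integral_of_dominated_convergence
    (fun t => M * (C * (t ^ n * Real.exp (-(z⁻¹.re * t))))) (fun m => ?_)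
    (((integrableOn_pow_mul_exp_neg_mul n hz).const_mul C).const_mul M) (fun m => ?_)
    (.of_forall fun t => ?_)).const_mul _
  · have hχc : Continuous fun t : ℝ => (χ (t / ((m : ℝ) + 1)) : ℂ) :=
      Complex.continuous_ofReal.comp (χ.continuous.comp (by fun_prop))
    exact (hf.continuous_ofReal.mul (hχc.mul (by fun_prop))).aestronglyMeasurable
  · filter_upwards [ae_restrict_mem measurableSet_Ioi] with t ht
    rw [mul_left_comm, norm_mul, norm_real]
    exact mul_le_mul (hM _) (norm_mul_cexp_le hC le_rfl ht) (norm_nonneg _)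
      ((norm_nonneg _).trans (hM 0))
  · simpa using ((tendsto_testFunction_dilate hχ t).mul_const (cexp (-(z⁻¹ * t)))).const_mul (f t)

end IsUpperRegular

theorem differentiableOn_ball_borel : DifferentiableOn ℂ borel (Metric.ball 0 (pole 0)) := by
  simpa using (hasFPowerSeriesOnBall_ofScalars_of_hasSum (pole_pos 0) fun t =>
    hasSum_borel).differentiableOn

theorem isBoundaryBorelTransform_boundaryDist_borel :
    IsBoundaryBorelTransform (sqrtSeries coeff) (boundaryDist borel) := by
  refine ⟨pole 0, Set.univ, borel, pole_pos 0, isOpen_univ, fun _ _ => Set.mem_univ _,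
    fun t ht => hasSum_borel (mem_ball_zero_iff.1 ht), ?_,
    isUpperRegular_borel.tendsto_integral_boundaryDist⟩
  rw [Set.univ_inter]
  exact differentiableOn_ball_borel.union_of_isOpen isUpperRegular_borel.differentiableOn
    Metric.isOpen_ball (isOpen_lt continuous_const continuous_im)

/-! ### Upper, lower and distributional Borel sums -/

theorem pair_conjDist_laplaceTest (T : 𝓓'((⊤ : TopologicalSpace.Opens ℝ), ℂ))
    (χ : 𝓓((⊤ : TopologicalSpace.Opens ℝ), ℝ)) (z : ℂ) (m : ℕ) :
    pair (conjDist T) (laplaceTest χ z m) = conj (pair T (laplaceTest χ (conj z) m)) := by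
  have hconj (t : ℝ) : laplaceTest χ (conj z) m t = conj (laplaceTest χ z m t) := by
    simp [laplaceTest_apply, ← exp_conj]
  have hre : TestFunction.postcompCLM reCLM (laplaceTest χ (conj z) m)
      = TestFunction.postcompCLM reCLM (laplaceTest χ z m) := by
    ext t
    simp only [TestFunction.postcompCLM_apply, Function.comp, reCLM_apply, hconj, conj_re]
  have him : TestFunction.postcompCLM imCLM (laplaceTest χ (conj z) m)
      = -TestFunction.postcompCLM imCLM (laplaceTest χ z m) := by
    ext t
    change (laplaceTest χ (conj z) m t).im = -(laplaceTest χ z m t).im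
    rw [hconj, conj_im]
  rw [pair, pair, hre, him, map_neg]
  simp [conjDist]

theorem HasLaplaceBorelIntegral.conj {T : 𝓓'((⊤ : TopologicalSpace.Opens ℝ), ℂ)} {z L : ℂ}
    (h : HasLaplaceBorelIntegral T (conj z) L) :
    HasLaplaceBorelIntegral (conjDist T) z (conj L) := fun χ hχ =>
  ((continuous_conj.tendsto L).comp (h χ hχ)).congr fun m => by simp [pair_conjDist_laplaceTest]

theorem pair_PP (T : 𝓓'((⊤ : TopologicalSpace.Opens ℝ), ℂ))
    (ψ : 𝓓((⊤ : TopologicalSpace.Opens ℝ), ℂ)) :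
    pair (PP T) ψ = (pair T ψ + pair (conjDist T) ψ) / 2 := by
  have happly (φ) : PP T φ = (1 / 2 : ℝ) • (T φ + conjDist T φ) := rfl
  rw [pair, pair, pair, happly, happly, real_smul, real_smul]
  push_cast
  ring

theorem HasLaplaceBorelIntegral.pp {T : 𝓓'((⊤ : TopologicalSpace.Opens ℝ), ℂ)} {z L L' : ℂ}
    (h : HasLaplaceBorelIntegral T z L) (h' : HasLaplaceBorelIntegral (conjDist T) z L') :
    HasLaplaceBorelIntegral (PP T) z ((L + L') / 2) := by
  refine fun χ hχ => (((h χ hχ).add (h' χ hχ)).div_const 2).congr fun m => ?_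
  rw [pair_PP]
  ring

theorem re_pos_of_mem_disk {R : ℝ} (hR : 0 < R) {z : ℂ} (hz : z ∈ disk R) : 0 < z.re := by
  simpa using inv_re_pos ((inv_pos.2 hR).trans hz)

theorem hasLaplaceBorelIntegral_upper {β : ℂ} (hβ : 0 < β.re) :
    HasLaplaceBorelIntegral (boundaryDist borel) β (S (β ^ 2)) := by
  rw [S_sq hβ]
  exact isUpperRegular_borel.hasLaplaceBorelIntegral (inv_re_pos hβ)

theorem hasLaplaceBorelIntegral_lower {β : ℂ} (hβ : 0 < β.re) :
    HasLaplaceBorelIntegral (conjDist (boundaryDist borel)) β (conj (S (conj (β ^ 2)))) := by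
  rw [map_pow]
  exact (hasLaplaceBorelIntegral_upper (by simpa using hβ)).conj

end

end Schwinger

theorem theorem1p1 :
    -- the improper integral defining `S(α)` converges on the slit plane, and `S` is analytic there
    (∀ α ∈ slitPlane, (∀ T : ℝ, 0 ≤ T →
        IntervalIntegrable (Schwinger.integrand α) volume 0 T) ∧
      Tendsto (Schwinger.actionUpTo α) atTop (𝓝 (Schwinger.S α))) ∧
    AnalyticOnNhd ℂ Schwinger.S slitPlane ∧
    -- sign and growth of the numbers `aₙ`
    (∀ n, 2 ≤ n → 0 < Schwinger.a n) ∧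
    Schwinger.a ~[atTop] (fun n : ℕ =>
      (4 / Real.pi) ^ n * ((2 * n).factorial : ℝ) / (32 * Real.pi ^ 2 * (n : ℝ) ^ 3)) ∧
    -- `∑ (-aₙ) αⁿ` is the perturbation expansion of `S`
    (∀ N : ℕ, (fun α : ℂ => Schwinger.S α - ∑ n ∈ Finset.range N, Schwinger.coeff n * α ^ n)
      =O[𝓝[{α : ℂ | 0 < α.re}] 0] (fun α : ℂ => α ^ N)) ∧
    -- upper, lower and distributional Borel sum in `β = √α`, on every `C_R`,
    -- hence for all `β` with `Re β > 0`, i.e. for all `α` in the slit plane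
    (∀ R : ℝ, 0 < R →
      Schwinger.IsUpperSum (Schwinger.sqrtSeries Schwinger.coeff) R
        (fun β => Schwinger.S (β ^ 2)) ∧
      Schwinger.IsLowerSum (Schwinger.sqrtSeries Schwinger.coeff) R
        (fun β => conj (Schwinger.S (conj (β ^ 2)))) ∧
      Schwinger.IsDistBorelSum (Schwinger.sqrtSeries Schwinger.coeff) R
        (fun β => (Schwinger.S (β ^ 2) + conj (Schwinger.S (conj (β ^ 2)))) / 2)) ∧
    -- for `α ≥ 0` the sum is the real part of `S`; at `α = 0` it is the constant term, `0`
    (∀ α : ℝ, 0 ≤ α →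
      (Schwinger.S α + conj (Schwinger.S (conj (α : ℂ)))) / 2 = ((Schwinger.S α).re : ℂ)) ∧
    Schwinger.S 0 = 0 := by
  refine ⟨fun α hα => Schwinger.converges hα, Schwinger.analyticOnNhd_S,
    fun n hn => Schwinger.a_pos hn, Schwinger.a_isEquivalent, Schwinger.expansion,
    fun R hR => ⟨?_, ?_, ?_⟩, fun α _ => Schwinger.half_add_conj_S, Schwinger.S_zero⟩
  all_goals refine ⟨_, Schwinger.isBoundaryBorelTransform_boundaryDist_borel, fun β hβ => ?_⟩
  all_goals have hβ' := Schwinger.re_pos_of_mem_disk hR hβ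
  · exact Schwinger.hasLaplaceBorelIntegral_upper hβ'
  · exact Schwinger.hasLaplaceBorelIntegral_lower hβ'
  · exact (Schwinger.hasLaplaceBorelIntegral_upper hβ').pp
      (Schwinger.hasLaplaceBorelIntegral_lower hβ')
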